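/- **Definitions.** An Orlicz N-function is a continuous even convex function $\varphi:\mathbb R\to\mathbb R$, increasing for $x>0$, with $\varphi(0)=0$, $\varphi(x)/x\to0$ as $x\to0$ and $\varphi(x)/x\to\infty$ as $x\to\infty$. It satisfies Condition Q if $\lim_{x\to0}\varphi(x)/x^2=C$ for some $C\in(0,+\infty]$. Its density is the nondecreasing right-continuous function $f$ on $[0,\infty)$ with $f(0)=0$, $f(x)\to\infty$ as $x\to\infty$ and $\varphi(u)=\int_0^{|u|}f(v)\,dv$; its Young–Fenchel transform is $\varphi^*(x)=\sup_{y\in\mathbb R}(xy-\varphi(y))$; $\varphi^{(-1)}$ is the inverse of $\varphi$ on $[0,\infty)$. Let $(\Omega,\mathcal B,\mathbf P)$ be a probability space. A zero mean random variable $\xi$ belongs to $Sub_\varphi(\Omega)$ if there is $a\ge0$ with $\mathbf E e^{\lambda\xi}\le e^{\varphi(a\lambda)}$ for all $\lambda\in\mathbb R$; put $\tau_\varphi(\xi)=\sup_{\lambda\ne0}\varphi^{(-1)}(\ln\mathbf E e^{\lambda\xi})/|\lambda|$. A process $X(t)$, $t\in\mathbb R$, is an $SSub_\varphi(\Omega)$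 (strictly $\varphi$-sub-Gaussian) process if $X(t)\in Sub_\varphi(\Omega)$ for all $t$ and there is a constant $C_X>0$ (a determinative constant) such that $\tau_\varphi(\sum_{i\in I}\lambda_iX(t_i))\le C_X\big(\mathbf E(\sum_{i\in I}\lambda_iX(t_i))^2\big)^{1/2}$ for every finite set $I$ and all $t_i,\lambda_i\in\mathbb R$. **Statement.** Let $\varphi$ be an Orlicz N-function satisfying Condition Q, with density $f$. Let $X(t)$, $t\in\mathbb R$, be a real measurable (jointly in $t$ and the sample point), centred, mean square continuous, (wide-sense) stationary $SSub_\varphi(\Omega)$ process with determinative constant $C_X$, covariance function $\mathbf B(\tau)=\mathbf E X(t+\tau)X(t)$ and spectral measure $F$, i.e. $F$ is the finite measure on $\mathbb R$ with $\mathbf B(\tau)=\int_{\mathbb R}e^{i\tau\lambda}\,dF(\lambda)$. Let $p\ge1$, $T>0$, $0<\Lambda<\omega$, $z\in(0,1)$, let $n$ be an integer with $n\ge\frac{\omega T}{\pi\sqrt z}$, and let $$X_n(t)=\sum_{k=-n}^n\frac{\sin(\omega(t-\frac{k\pi}\omega))}{\omega(t-\frac{k\pi}\omega)}\,X\Big(\frac{k\pi}\omega\Big)$$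 (a quotient $\sin(0)/0$ being read as $1$). Put $$C_n(t,\Lambda)=\mathbf B(0)\Big(\frac{4\omega t}{\pi^2(1-z)}+\frac{4(z+1+\frac1n)}{\pi(1-z)^2(1-\frac\Lambda\omega)}\Big)^2,$$ $$D_n(t)=2+\frac{2|\sin(\omega t)|}{\pi}\Big(1+\int_0^\pi\frac{\sin u}{u}\,du+\frac{\frac{\omega t}\pi+0.5}{n-\frac{\omega t}\pi}\Big),$$ $$A_n(t,\Lambda)=\frac{\sqrt{C_n(t,\Lambda)}}n+D_n(t)\,F(\{\lambda:|\lambda|>\Lambda\})^{1/2},\qquad S_{n,p}=C_X^p\int_0^TA_n(t,\Lambda)^p\,dt.$$ Let $\varepsilon>0$ and $0<\delta<1$. If $$\varepsilon>S_{n,p}\Big(f\big(p\,(S_{n,p}/\varepsilon)^{1/p}\big)\Big)^p\quad\text{and}\quad\exp\Big\{-\varphi^*\big((\varepsilon/S_{n,p})^{1/p}\big)\Big\}\le\frac\delta2$$ (in the degenerate case $S_{n,p}=0$ the left-hand side of the second inequality is read as $0$), then $X_n$ approximates $X$ in $L_p([0,T])$ with accuracy $\varepsilon$ and reliability $1-\delta$: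 the integral $\int_0^T|X(t)-X_n(t)|^p\,dt$ exists with probability $1$, and $$\mathbf P\Big\{\int_0^T|X(t)-X_n(t)|^p\,dt>\varepsilon\Big\}\le\delta.$$ -/

import Mathlib

open MeasureTheory ProbabilityTheory Filter Topology

noncomputable section

namespace WKS

/-! ### Orlicz N-functions -/

/-- An Orlicz N-function: a continuous even convex function, increasing for `x > 0`, with
`φ 0 = 0`, `φ x / x → 0` as `x → 0` and `φ x / x → ∞` as `x → ∞`. -/
structure IsOrliczNFunction (φ : ℝ → ℝ) : Prop where
  continuous : Continuous φ
  even : ∀ x, φ (-x) = φ x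
  convexOn : ConvexOn ℝ Set.univ φ
  strictMonoOn : StrictMonoOn φ (Set.Ioi 0)
  map_zero : φ 0 = 0
  tendsto_zero : Tendsto (fun x => φ x / x) (𝓝[≠] 0) (𝓝 0)
  tendsto_atTop : Tendsto (fun x => φ x / x) atTop atTop

/-- Condition Q: `φ x / x ^ 2` has a limit `C > 0` as `x → 0`, where `C = +∞` is allowed. -/
def ConditionQ (φ : ℝ → ℝ) : Prop :=
  (∃ C : ℝ, 0 < C ∧ Tendsto (fun x => φ x / x ^ 2) (𝓝[≠] 0) (𝓝 C)) ∨
    Tendsto (fun x => φ x / x ^ 2) (𝓝[≠] 0) atTop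

/-- The Young-Fenchel transform `φ* x = sup_y (x y - φ y)`; for an Orlicz N-function the
supremum is over a set of reals that is bounded above. -/
def youngFenchel (φ : ℝ → ℝ) (x : ℝ) : ℝ := ⨆ y : ℝ, (x * y - φ y)

/-- `f` is the density of `φ`: it is nondecreasing and right-continuous on `[0, ∞)`, `f 0 = 0`,
`f x → ∞` as `x → ∞`, and `φ u = ∫_0^{|u|} f v dv`. This determines `f` on `[0, ∞)`. -/
structure IsDensity (φ f : ℝ → ℝ) : Prop where
  monotoneOn : MonotoneOn f (Set.Ici 0)
  rightContinuous : ∀ x, 0 ≤ x → ContinuousWithinAt f (Set.Ici x) x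
  map_zero : f 0 = 0
  tendsto_atTop : Tendsto f atTop atTop
  integral_eq : ∀ u, φ u = ∫ v in (0 : ℝ)..|u|, f v

/-- The inverse `φ⁽⁻¹⁾ : [0, ∞) → [0, ∞)` of an Orlicz N-function. -/
def orliczInv (φ : ℝ → ℝ) (y : ℝ) : ℝ := Function.invFunOn φ (Set.Ici 0) y

/-! ### Random variables and processes that are (strictly) `φ`-sub-Gaussian -/

section Probability

variable {Ω : Type*} [MeasurableSpace Ω]

/-- `ξ ∈ Sub_φ(Ω)`: a zero mean random variable such that, for some `a ≥ 0`,
`E exp (l ξ) ≤ exp (φ (a l))` for all real `l` (in particular, these expectations are finite). -/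
def IsSub (φ : ℝ → ℝ) (P : Measure Ω) (ξ : Ω → ℝ) : Prop :=
  Integrable ξ P ∧ ∫ w, ξ w ∂P = 0 ∧
    ∃ a : ℝ, 0 ≤ a ∧ ∀ l : ℝ, Integrable (fun w => Real.exp (l * ξ w)) P ∧
      ∫ w, Real.exp (l * ξ w) ∂P ≤ Real.exp (φ (a * l))

/-- The norm `τ_φ(ξ) = sup_{l ≠ 0} φ⁽⁻¹⁾(ln E exp (l ξ)) / |l|` of `Sub_φ(Ω)`, with the supremum
taken in `[0, ∞]` (it is finite for `ξ ∈ Sub_φ(Ω)`). -/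
def tau (φ : ℝ → ℝ) (P : Measure Ω) (ξ : Ω → ℝ) : ENNReal :=
  ⨆ (l : ℝ) (_ : l ≠ 0),
    ENNReal.ofReal (orliczInv φ (Real.log (∫ w, Real.exp (l * ξ w) ∂P)) / |l|)

/-- `C` is a determinative constant of the family `Ξ`. -/
def IsDeterminativeConstant {ι : Type*} (φ : ℝ → ℝ) (P : Measure Ω) (Ξ : ι → Ω → ℝ)
    (C : ℝ) : Prop :=
  0 < C ∧ ∀ (I : Finset ι) (l : ι → ℝ),
    tau φ P (fun w => ∑ i ∈ I, l i * Ξ i w) ≤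
      ENNReal.ofReal (C * Real.sqrt (∫ w, (∑ i ∈ I, l i * Ξ i w) ^ 2 ∂P))

/-- The family (or process) `Ξ` is strictly `Sub_φ(Ω)`. -/
def IsSSub {ι : Type*} (φ : ℝ → ℝ) (P : Measure Ω) (Ξ : ι → Ω → ℝ) : Prop :=
  (∀ i, IsSub φ P (Ξ i)) ∧ ∃ C : ℝ, IsDeterminativeConstant φ P Ξ C

/-- `X` is a centred (wide-sense) stationary mean square continuous real process. -/
structure IsStationary (P : Measure Ω) (X : ℝ → Ω → ℝ) : Prop where
  memLp : ∀ t, MemLp (X t) 2 P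
  mean_zero : ∀ t, ∫ w, X t w ∂P = 0
  covariance : ∀ s t h, ∫ w, X (s + h) w * X (t + h) w ∂P = ∫ w, X s w * X t w ∂P
  meanSquareContinuous :
    ∀ t, Tendsto (fun s => ∫ w, (X s w - X t w) ^ 2 ∂P) (𝓝 t) (𝓝 0)

/-- The covariance function `B(r) = E X(t + r) X(t)` of a stationary process (here `t = 0`). -/
def covFun (P : Measure Ω) (X : ℝ → Ω → ℝ) (r : ℝ) : ℝ := ∫ w, X r w * X 0 w ∂P

/-- `F` is the spectral measure of `X`: the finite measure on `ℝ` with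
`B(r) = ∫ exp (i r x) dF(x)` for all real `r`. -/
def IsSpectralMeasure (P : Measure Ω) (X : ℝ → Ω → ℝ) (F : Measure ℝ) : Prop :=
  IsFiniteMeasure F ∧
    ∀ r : ℝ, (covFun P X r : ℂ) = ∫ x : ℝ, Complex.exp (Complex.I * (r : ℂ) * (x : ℂ)) ∂F

/-! ### Truncated Whittaker-Kotel'nikov-Shannon sums and the error bounds -/

/-- `X_n(t) = ∑_{k=-n}^n sin(ω (t - kπ/ω)) / (ω (t - kπ/ω)) · X(kπ/ω)`, where the quotient is `1`
when its denominator vanishes. -/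
def truncated (ω : ℝ) (n : ℕ) (X : ℝ → Ω → ℝ) (t : ℝ) (w : Ω) : ℝ :=
  ∑ k ∈ Finset.Icc (-(n : ℤ)) (n : ℤ),
    Real.sinc (ω * (t - (k : ℝ) * Real.pi / ω)) * X ((k : ℝ) * Real.pi / ω) w

/-- The process `Y` approximates `X` in `L_p([0,T])` with accuracy `ε` and reliability `1 - δ`:
`∫_0^T |X(t) - Y(t)|^p dt` exists with probability one, and it exceeds `ε` with probability at
most `δ`. -/
def ApproximatesInLp (P : Measure Ω) (X Y : ℝ → Ω → ℝ) (p T ε δ : ℝ) : Prop :=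
  (∀ᵐ w ∂P, IntegrableOn (fun t => |X t w - Y t w| ^ p) (Set.Icc 0 T)) ∧
    P {w | ε < ∫ t in Set.Icc 0 T, |X t w - Y t w| ^ p} ≤ ENNReal.ofReal δ

end Probability

/-- The sine integral `Si(x) = ∫_0^x sin u / u du`. -/
def Si (x : ℝ) : ℝ := ∫ u in (0 : ℝ)..x, Real.sinc u

/-- `C_n(t, Λ)`, with `B0 = B(0)`. -/
def coefC (B0 ω z : ℝ) (n : ℕ) (t Λ : ℝ) : ℝ :=
  B0 * (4 * ω * t / (Real.pi ^ 2 * (1 - z)) +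
    4 * (z + 1 + 1 / (n : ℝ)) / (Real.pi * (1 - z) ^ 2 * (1 - Λ / ω))) ^ 2

/-- `D_n(t)`. -/
def coefD (ω : ℝ) (n : ℕ) (t : ℝ) : ℝ :=
  2 + 2 * |Real.sin (ω * t)| / Real.pi *
    (1 + Si Real.pi + (ω * t / Real.pi + 0.5) / ((n : ℝ) - ω * t / Real.pi))

/-- `A_n(t, Λ) = √C_n(t, Λ) / n + D_n(t) (∫_{|x| > Λ} dF(x))^{1/2}`. -/
def boundA (B0 : ℝ) (F : Measure ℝ) (ω z : ℝ) (n : ℕ) (t Λ : ℝ) : ℝ :=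
  Real.sqrt (coefC B0 ω z n t Λ) / (n : ℝ) +
    coefD ω n t * Real.sqrt (F.real {x : ℝ | Λ < |x|})

/-- `S_{n,p} = C_X^p ∫_0^T A_n(t, Λ)^p dt`. -/
def boundS (CX B0 : ℝ) (F : Measure ℝ) (ω z : ℝ) (n : ℕ) (Λ p T : ℝ) : ℝ :=
  CX ^ p * ∫ t in Set.Icc 0 T, boundA B0 F ω z n t Λ ^ p

end WKS

end

namespace WKS

/-! ### Partial sums of the sine series of the sawtooth -/

/-! The proof has a deterministic half and a probabilistic half, joined by the spectral isometry
`IsSpectralMeasure.integral_sum_sq`. For fixed `t`, the mean square of `X t - X_n t` is the `L²(F)`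
norm squared of the error of the truncated cardinal series of an exponential, `cardinalError τ θ n`
with `τ = ωt/π` and `θ = πx/ω`.

Two estimates of that error are needed. For arbitrary frequency (`norm_cardinalError_le`), the
window of summation is split into a part symmetric about the integer nearest `τ` and about `2τ` far
terms. Pairing opposite indices in the symmetric part leaves an absolutely convergent cosine series
and, up to a summable error, the partial sums of `∑ sin(jx)/j`; these never exceed `Si π`, which
gives `D_n`. For `|θ| < π` (`norm_cardinalError_le_of_abs_lt`), multiplication by `1 + exp(iθ)` adds
consecutive coefficients; their alternating signs turn the sums into `O(1/k²)` differences with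
telescoping tails, and division by `|1 + exp(iθ)| = 2 cos(θ/2)` gives a bound of order `1/n`,
absorbed by `C_n`. Integrating the second bound over `|x| ≤ Λ` and the first over `|x| > Λ` bounds
the mean square by `A_n²`.

The determinative constant then gives `τ_φ(X t - X_n t) ≤ C_X A_n(t)`, hence a moment generating
function at most `exp(φ(C_X A_n(t) l))` and bounds for all absolute moments. Jensen's inequality
with respect to the weight `(C_X A_n)^p dt`, of total mass `S`, carries these over to moments of
`∫|X - X_n|^p` (`lintegral_rpow_lintegral_le`). With `u = (ε/S)^{1/p}`, Markov's inequality for the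
moment of order `s = ul` yields the tail bound `2 exp(-(ul - φ l))`, provided `s ≥ p`, that is `l ≥
p/u`. The condition on `f` says that `l ↦ ul - φ l` does not decrease before `p/u`, so the
restriction on `l` is harmless and the supremum over all `l` produces `φ*(u)`. -/

theorem hasDerivAt_Si (x : ℝ) : HasDerivAt Si (Real.sinc x) x :=
  intervalIntegral.integral_hasDerivAt_right (Real.continuous_sinc.intervalIntegrable 0 x)
    Real.continuous_sinc.aestronglyMeasurable.stronglyMeasurableAtFilter
    Real.continuous_sinc.continuousAt

@[simp] theorem Si_zero : Si 0 = 0 := by simp [Si]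

theorem continuous_Si : Continuous Si :=
  continuous_iff_continuousAt.2 fun x => (hasDerivAt_Si x).continuousAt

theorem Si_le_Si_pi_of_le {x : ℝ} (hx0 : 0 ≤ x) (hx : x ≤ Real.pi) : Si x ≤ Si Real.pi := by
  have hmono : MonotoneOn Si (Set.Icc 0 Real.pi) := by
    refine monotoneOn_of_deriv_nonneg (convex_Icc _ _) continuous_Si.continuousOn
      (fun y _ => (hasDerivAt_Si y).differentiableAt.differentiableWithinAt) fun y hy => ?_
    rw [interior_Icc] at hy
    rw [(hasDerivAt_Si y).deriv, Real.sinc_of_ne_zero hy.1.ne']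
    exact div_nonneg (Real.sin_nonneg_of_nonneg_of_le_pi hy.1.le hy.2.le) hy.1.le
  exact hmono ⟨hx0, hx⟩ ⟨Real.pi_pos.le, le_rfl⟩ hx

theorem Si_le_Si_pi_of_ge {x : ℝ} (hx : Real.pi ≤ x) : Si x ≤ Si Real.pi := by
  -- The correction `(1 + cos u)/u` is nonnegative for `u > 0`, vanishes at `π`, and cancels the
  -- oscillating derivative of `Si`, so the sum is nonincreasing.
  have hd : ∀ y : ℝ, y ≠ 0 → HasDerivAt (fun u => Si u + (1 + Real.cos u) / u)
      (-((1 + Real.cos y) / y ^ 2)) y := by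
    intro y hy
    have h := (hasDerivAt_Si y).add
      (((Real.hasDerivAt_cos y).const_add 1).div (hasDerivAt_id' y) hy)
    refine HasDerivAt.congr_deriv h ?_
    rw [Real.sinc_of_ne_zero hy]
    field_simp
    ring
  have hpos : ∀ y ∈ Set.Ici Real.pi, y ≠ 0 := fun y hy =>
    (Real.pi_pos.trans_le hy).ne'
  have hanti : AntitoneOn (fun u => Si u + (1 + Real.cos u) / u) (Set.Ici Real.pi) := by
    refine antitoneOn_of_deriv_nonpos (convex_Ici _)
      (fun y hy => (hd y (hpos y hy)).continuousAt.continuousWithinAt)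
      (fun y hy => (hd y (hpos y (interior_subset hy))).differentiableAt.differentiableWithinAt)
      fun y hy => ?_
    rw [(hd y (hpos y (interior_subset hy))).deriv]
    have := Real.neg_one_le_cos y
    have : 0 ≤ (1 + Real.cos y) / y ^ 2 := div_nonneg (by linarith) (sq_nonneg y)
    linarith
  have h := hanti (Set.mem_Ici.2 le_rfl) (Set.mem_Ici.2 hx) hx
  simp only [Real.cos_pi, add_neg_cancel, zero_div, add_zero] at h
  have h2 := Real.neg_one_le_cos x
  have : 0 ≤ (1 + Real.cos x) / x :=
    div_nonneg (by linarith) (Real.pi_pos.le.trans hx)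
  linarith

theorem Si_le_Si_pi {x : ℝ} (hx0 : 0 ≤ x) : Si x ≤ Si Real.pi :=
  (le_total x Real.pi).elim (Si_le_Si_pi_of_le hx0) Si_le_Si_pi_of_ge

/-- Jordan's inequality bounds `sinc` below by `2/π` on `[0, π/2]`, where the integral is then
already at least `1`. -/
theorem one_le_Si_pi : 1 ≤ Si Real.pi := by
  refine le_trans ?_ (Si_le_Si_pi (x := Real.pi / 2) (by positivity))
  have hpi := Real.pi_pos
  have h : ∫ _ in (0 : ℝ)..(Real.pi / 2), (2 / Real.pi) ≤ Si (Real.pi / 2) := by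
    refine intervalIntegral.integral_mono_on (by positivity) (by simp)
      (Real.continuous_sinc.intervalIntegrable _ _) fun x hx => ?_
    rcases hx.1.eq_or_lt with rfl | hx0
    · rw [Real.sinc_zero, div_le_one hpi]
      exact Real.two_le_pi
    · rw [Real.sinc_of_ne_zero hx0.ne', le_div_iff₀ hx0]
      exact Real.mul_le_sin hx.1 hx.2
  rw [intervalIntegral.integral_const] at h
  refine le_trans (le_of_eq ?_) h
  rw [smul_eq_mul]
  field_simp
  ring

/-- The partial sum `∑_{j=1}^m sin (j x) / j`. -/
noncomputable def sineSum (m : ℕ) (x : ℝ) : ℝ :=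
  ∑ j ∈ Finset.range m, Real.sin (((j : ℝ) + 1) * x) / ((j : ℝ) + 1)

theorem hasDerivAt_sineSum (m : ℕ) (x : ℝ) :
    HasDerivAt (sineSum m) (∑ j ∈ Finset.range m, Real.cos (((j : ℝ) + 1) * x)) x := by
  unfold sineSum
  refine HasDerivAt.fun_sum fun j _ => ?_
  have hj : (j : ℝ) + 1 ≠ 0 := by positivity
  have h := (((hasDerivAt_id' x).const_mul ((j : ℝ) + 1)).sin).div_const ((j : ℝ) + 1)
  refine h.congr_deriv ?_
  field_simp

theorem two_mul_sin_mul_sum_cos (m : ℕ) (x : ℝ) :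
    2 * Real.sin (x / 2) * ∑ j ∈ Finset.range m, Real.cos (((j : ℝ) + 1) * x) =
      Real.sin (((m : ℝ) + 1 / 2) * x) - Real.sin (x / 2) := by
  induction m with
  | zero => simp; ring_nf
  | succ m ih =>
    rw [Finset.sum_range_succ, mul_add, ih]
    have h1 : Real.sin ((((m + 1 : ℕ) : ℝ) + 1 / 2) * x) =
        Real.sin (((m : ℝ) + 1) * x + x / 2) := by push_cast; ring_nf
    have h2 : Real.sin (((m : ℝ) + 1 / 2) * x) =
        Real.sin (((m : ℝ) + 1) * x - x / 2) := by ring_nf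
    rw [h1, h2, Real.sin_add, Real.sin_sub]
    ring

/-- The Fejér-Jackson inequality. At an interior minimum the derivative vanishes, which forces the
last term of the sum to be nonnegative there; the rest is nonnegative by induction. -/
theorem sineSum_nonneg (m : ℕ) {x : ℝ} (hx : x ∈ Set.Icc 0 Real.pi) : 0 ≤ sineSum m x := by
  induction m generalizing x with
  | zero => simp [sineSum]
  | succ m ih =>
    have hcont : Continuous (sineSum (m + 1)) :=
      continuous_iff_continuousAt.2 fun y => (hasDerivAt_sineSum _ y).continuousAt
    obtain ⟨y, hy, hmin⟩ := isCompact_Icc.exists_isMinOn (Set.nonempty_Icc.2 Real.pi_pos.le)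
      hcont.continuousOn
    refine le_trans ?_ (hmin hx)
    rcases hy.1.eq_or_lt with rfl | hy0
    · simp [sineSum]
    rcases hy.2.eq_or_lt with rfl | hypi
    · refine (Finset.sum_eq_zero fun j _ => ?_).ge
      have := Real.sin_nat_mul_pi (j + 1)
      push_cast at this
      rw [this, zero_div]
    have hd := (hmin.isLocalMin (Icc_mem_nhds hy0 hypi)).hasDerivAt_eq_zero
      (hasDerivAt_sineSum (m + 1) y)
    have hsin := two_mul_sin_mul_sum_cos (m + 1) y
    rw [hd, mul_zero, eq_comm, sub_eq_zero] at hsin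
    have hs2 : 0 < Real.sin (y / 2) :=
      Real.sin_pos_of_pos_of_lt_pi (by linarith) (by linarith [Real.pi_pos])
    have hc2 : 0 < Real.cos (y / 2) :=
      Real.cos_pos_of_mem_Ioo ⟨by linarith [Real.pi_pos], by linarith⟩
    -- Criticality gives `sin((m + 3/2)y) = sin(y/2)`, so the two cosines agree up to sign and
    -- `sin((m + 1)y)` is either `0` or `sin y`.
    have hlast : 0 ≤ Real.sin (((m : ℝ) + 1) * y) := by
      have e : ((m : ℝ) + 1) * y = (((m + 1 : ℕ) : ℝ) + 1 / 2) * y - y / 2 := by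
        push_cast; ring
      rw [e, Real.sin_sub, hsin]
      have hsq : Real.cos ((((m + 1 : ℕ) : ℝ) + 1 / 2) * y) ^ 2 = Real.cos (y / 2) ^ 2 := by
        rw [Real.cos_sq', Real.cos_sq', hsin]
      rcases sq_eq_sq_iff_eq_or_eq_neg.1 hsq with h | h <;> rw [h]
      · nlinarith
      · nlinarith [mul_pos hs2 hc2]
    rw [sineSum, Finset.sum_range_succ]
    exact add_nonneg (ih hy) (div_nonneg hlast (by positivity))

/-- Measures how far the Dirichlet kernel is from its `sinc` approximation; the upper bound `1` is
what makes the derivative in `sineSum_le_Si_pi` nonnegative. -/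
theorem inv_sin_sub_inv_mem {y : ℝ} (hy0 : 0 < y) (hy : y ≤ Real.pi / 2) :
    0 ≤ 1 / Real.sin y - 1 / y ∧ 1 / Real.sin y - 1 / y ≤ 1 := by
  have hpi := Real.pi_pos
  have hs : 0 < Real.sin y := Real.sin_pos_of_pos_of_lt_pi hy0 (by linarith)
  constructor
  · rw [sub_nonneg]
    exact one_div_le_one_div_of_le hs (Real.sin_lt hy0).le
  · rw [div_sub_div _ _ hs.ne' hy0.ne', div_le_one (by positivity)]
    rcases le_total y 1 with h1 | h1
    · have := Real.sin_gt_sub_cube hy0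
      nlinarith [mul_pos hy0 hy0, mul_nonneg hy0.le (sub_nonneg.2 h1),
        mul_nonneg (mul_nonneg hy0.le hy0.le) (sub_nonneg.2 h1),
        mul_nonneg (mul_nonneg hy0.le hy0.le) (mul_nonneg hy0.le (sub_nonneg.2 h1))]
    · have h := Real.mul_le_sin hy0.le hy
      have h4 : Real.pi ≤ 4 := Real.pi_le_four
      have : y / 2 ≤ Real.sin y := by
        refine le_trans ?_ h
        rw [div_eq_mul_inv, mul_comm]
        refine mul_le_mul_of_nonneg_right ?_ hy0.le
        rw [inv_eq_one_div, div_le_div_iff₀ (by norm_num) hpi]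
        linarith
      nlinarith

/-- With `c = m + 1/2`, the difference `Si (c x) - sineSum m x` vanishes at `0` and has derivative
`(1 - sin(cx) g)/2` with `g ∈ [0, 1]`. Hence the partial sum stays below `Si (c x)`, itself at most
`Si π`. -/
theorem sineSum_le_Si_pi (m : ℕ) {x : ℝ} (hx : x ∈ Set.Icc 0 Real.pi) :
    sineSum m x ≤ Si Real.pi := by
  set c : ℝ := (m : ℝ) + 1 / 2 with hc
  have hc0 : 0 < c := by positivity
  have hd : ∀ y, HasDerivAt (fun u => Si (c * u) - sineSum m u)
      (Real.sinc (c * y) * c - ∑ j ∈ Finset.range m, Real.cos (((j : ℝ) + 1) * y)) y := by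
    intro y
    have h1 : HasDerivAt (fun u : ℝ => c * u) c y := by
      simpa using (hasDerivAt_id' y).const_mul c
    exact ((hasDerivAt_Si (c * y)).comp y h1).sub (hasDerivAt_sineSum m y)
  have hmono : MonotoneOn (fun u => Si (c * u) - sineSum m u) (Set.Icc 0 Real.pi) := by
    refine monotoneOn_of_deriv_nonneg (convex_Icc _ _)
      (fun y _ => (hd y).continuousAt.continuousWithinAt)
      (fun y _ => (hd y).differentiableAt.differentiableWithinAt) fun y hy => ?_
    rw [interior_Icc] at hy
    rw [(hd y).deriv, Real.sinc_of_ne_zero (mul_pos hc0 hy.1).ne']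
    have hs2 : 0 < Real.sin (y / 2) :=
      Real.sin_pos_of_pos_of_lt_pi (by linarith [hy.1]) (by linarith [hy.2, Real.pi_pos])
    obtain ⟨g0, g1⟩ := inv_sin_sub_inv_mem (y := y / 2) (by linarith [hy.1]) (by linarith [hy.2])
    set g := 1 / Real.sin (y / 2) - 1 / (y / 2) with hg
    have hsum : ∑ j ∈ Finset.range m, Real.cos (((j : ℝ) + 1) * y) =
        Real.sin (c * y) / (2 * Real.sin (y / 2)) - 1 / 2 := by
      have := two_mul_sin_mul_sum_cos m y
      rw [← hc] at this
      rw [eq_sub_iff_add_eq, eq_div_iff (by positivity)]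
      linarith
    have hy0 := hy.1.ne'
    have e : Real.sin (c * y) / (c * y) * c - ∑ j ∈ Finset.range m, Real.cos (((j : ℝ) + 1) * y)
        = (1 - Real.sin (c * y) * g) / 2 := by
      rw [hsum, hg]
      field_simp
      ring
    rw [e]
    nlinarith [Real.sin_le_one (c * y)]
  have h := hmono (Set.left_mem_Icc.2 Real.pi_pos.le) hx hx.1
  simp only [mul_zero, Si_zero] at h
  have h0 : sineSum m 0 = 0 := by simp [sineSum]
  have := Si_le_Si_pi (mul_nonneg hc0.le hx.1)
  linarith

theorem sineSum_neg (m : ℕ) (x : ℝ) : sineSum m (-x) = -sineSum m x := by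
  simp [sineSum, neg_div]

/-- The partial sums of `∑ sin (j x) / j` are bounded by the Wilbraham-Gibbs constant `Si π`. -/
theorem abs_sineSum_le (m : ℕ) (x : ℝ) : |sineSum m x| ≤ Si Real.pi := by
  have key : ∀ y : ℝ, |y| ≤ Real.pi → |sineSum m y| ≤ Si Real.pi := by
    intro y hy
    rcases le_total 0 y with h | h
    · rw [abs_of_nonneg h] at hy
      rw [abs_of_nonneg (sineSum_nonneg m ⟨h, hy⟩)]
      exact sineSum_le_Si_pi m ⟨h, hy⟩
    · rw [abs_of_nonpos h] at hy
      have h' : -y ∈ Set.Icc 0 Real.pi := ⟨by linarith, hy⟩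
      rw [← abs_neg, ← sineSum_neg, abs_of_nonneg (sineSum_nonneg m h')]
      exact sineSum_le_Si_pi m h'
  have hpi := Real.pi_pos
  set q : ℤ := round (x / (2 * Real.pi)) with hq
  have hper : sineSum m x = sineSum m (x - q * (2 * Real.pi)) := by
    refine Finset.sum_congr rfl fun j _ => ?_
    congr 1
    have := Real.sin_sub_int_mul_two_pi (((j : ℝ) + 1) * x) ((j + 1) * q)
    rw [← this]
    push_cast
    ring_nf
  rw [hper]
  apply key
  have h := abs_sub_round (x / (2 * Real.pi))
  rw [← hq] at h
  have e : x - q * (2 * Real.pi) = (x / (2 * Real.pi) - q) * (2 * Real.pi) := by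
    field_simp
  rw [e, abs_mul, abs_of_pos (by positivity : 0 < 2 * Real.pi)]
  nlinarith

/-! ### The truncated cardinal series of an exponential -/

theorem sum_Icc_neg_succ {M : Type*} [AddCommMonoid M] (f : ℤ → M) (m : ℕ) :
    ∑ k ∈ Finset.Icc (-((m + 1 : ℕ) : ℤ)) ((m + 1 : ℕ) : ℤ), f k =
      ∑ k ∈ Finset.Icc (-(m : ℤ)) (m : ℤ), f k + (f ((m : ℤ) + 1) + f (-((m : ℤ) + 1))) := by
  have h : Finset.Icc (-((m + 1 : ℕ) : ℤ)) ((m + 1 : ℕ) : ℤ) =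
      insert ((m : ℤ) + 1) (insert (-((m : ℤ) + 1)) (Finset.Icc (-(m : ℤ)) (m : ℤ))) := by
    ext k
    simp only [Finset.mem_Icc, Finset.mem_insert]
    omega
  rw [h, Finset.sum_insert (by simp only [Finset.mem_Icc, Finset.mem_insert]; omega),
    Finset.sum_insert (by simp only [Finset.mem_Icc]; omega)]
  ac_rfl

/-- The complex exponential `exp (i x)`. -/
noncomputable def cis (x : ℝ) : ℂ := Complex.exp (x * Complex.I)

theorem norm_cis (x : ℝ) : ‖cis x‖ = 1 := Complex.norm_exp_ofReal_mul_I x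

theorem cis_add (x y : ℝ) : cis (x + y) = cis x * cis y := by
  simp [cis, add_mul, Complex.exp_add]

theorem cis_eq (x : ℝ) : cis x = (Real.cos x : ℂ) + (Real.sin x : ℂ) * Complex.I := by
  rw [cis, Complex.exp_mul_I, Complex.ofReal_cos, Complex.ofReal_sin]

theorem continuous_cis : Continuous cis := by
  unfold cis
  fun_prop

/-- The error of the truncated cardinal series of `exp (i τ θ)`. -/
noncomputable def cardinalError (τ θ : ℝ) (n : ℕ) : ℂ :=
  cis (τ * θ) - ∑ k ∈ Finset.Icc (-(n : ℤ)) (n : ℤ),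
    (Real.sinc (Real.pi * (τ - k)) : ℂ) * cis (k * θ)

theorem sinc_pi_mul_sub_int {τ : ℝ} {k : ℤ} (h : τ ≠ k) :
    Real.sinc (Real.pi * (τ - k)) =
      (-1) ^ k * Real.sin (Real.pi * τ) / (Real.pi * (τ - k)) := by
  rw [Real.sinc_of_ne_zero (mul_ne_zero Real.pi_ne_zero (sub_ne_zero.2 h)), mul_sub,
    mul_comm Real.pi (k : ℝ), Real.sin_sub_int_mul_pi]

theorem abs_neg_one_zpow (k : ℤ) : |(-1 : ℝ) ^ k| = 1 := by
  rw [abs_zpow]; simp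

theorem abs_sinc_pi_mul_sub_int {τ : ℝ} {k : ℤ} (h : τ ≠ k) :
    |Real.sinc (Real.pi * (τ - k))| = |Real.sin (Real.pi * τ)| / (Real.pi * |τ - k|) := by
  rw [sinc_pi_mul_sub_int h, abs_div, abs_mul, abs_mul, abs_neg_one_zpow, one_mul,
    abs_of_pos Real.pi_pos]

theorem abs_sinc_pi_mul_sub_int_le {τ : ℝ} {k : ℤ} (h : τ ≠ k) :
    |Real.sinc (Real.pi * (τ - k))| ≤ 1 / (Real.pi * |τ - k|) := by
  rw [abs_sinc_pi_mul_sub_int h]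
  have := Real.abs_sin_le_one (Real.pi * τ)
  gcongr

/-- Telescopes, since `(j + 1)² - 1/4 = (j + 1/2)(j + 3/2)`. -/
theorem sum_inv_sq_sub_quarter (m : ℕ) :
    ∑ j ∈ Finset.range m, 1 / (((j : ℝ) + 1) ^ 2 - 1 / 4) = 2 - 1 / ((m : ℝ) + 1 / 2) := by
  induction m with
  | zero => norm_num
  | succ m ih =>
    rw [Finset.sum_range_succ, ih]
    have h1 : ((m : ℝ) + 1) ^ 2 - 1 / 4 = (m + 1 / 2) * (m + 1 + 1 / 2) := by ring
    rw [h1]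
    have h2 : (m : ℝ) + 1 / 2 ≠ 0 := by positivity
    have h3 : (m : ℝ) + 1 + 1 / 2 ≠ 0 := by positivity
    push_cast
    field_simp
    ring

theorem sum_inv_sq_sub_quarter_le (m : ℕ) :
    ∑ j ∈ Finset.range m, 1 / (((j : ℝ) + 1) ^ 2 - 1 / 4) ≤ 2 := by
  rw [sum_inv_sq_sub_quarter]
  have : 0 ≤ 1 / ((m : ℝ) + 1 / 2) := by positivity
  linarith

/-- The indices `k` and `-k` are combined by partial fractions; shifting `θ` by `π` absorbs the
alternating sign. The cosine part is absolutely convergent, and only the sine part needs a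
Gibbs-type bound. -/
theorem sum_symmetric_sinc_eq {r : ℝ} (hr : |r| ≤ 1 / 2) (θ : ℝ) (m : ℕ) :
    ∑ k ∈ Finset.Icc (-(m : ℤ)) (m : ℤ), (Real.sinc (Real.pi * (r - k)) : ℂ) * cis (k * θ) =
      Real.sinc (Real.pi * r) - ((Real.sin (Real.pi * r) / Real.pi : ℝ) : ℂ) *
        (((∑ j ∈ Finset.range m, 2 * r * Real.cos (((j : ℝ) + 1) * (θ + Real.pi)) /
            (((j : ℝ) + 1) ^ 2 - r ^ 2) : ℝ) : ℂ) +
          ((∑ j ∈ Finset.range m, 2 * ((j : ℝ) + 1) * Real.sin (((j : ℝ) + 1) * (θ + Real.pi)) /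
            (((j : ℝ) + 1) ^ 2 - r ^ 2) : ℝ) : ℂ) * Complex.I) := by
  obtain ⟨hr1, hr2⟩ := abs_le.1 hr
  induction m with
  | zero => simp [cis]
  | succ m ih =>
    rw [sum_Icc_neg_succ, ih, Finset.sum_range_succ, Finset.sum_range_succ]
    have hm : (0 : ℝ) ≤ m := m.cast_nonneg
    have n1 : r - (m + 1) ≠ 0 := by intro h; linarith
    have n2 : r + (m + 1) ≠ 0 := by intro h; linarith
    have n3 : ((m : ℝ) + 1) ^ 2 - r ^ 2 ≠ 0 := by
      have : ((m : ℝ) + 1) ^ 2 - r ^ 2 = -((r - (m + 1)) * (r + (m + 1))) := by ring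
      rw [this]
      exact neg_ne_zero.2 (mul_ne_zero n1 n2)
    have e1 : Real.sinc (Real.pi * (r - (((m : ℤ) + 1 : ℤ) : ℝ))) =
        (-1) ^ ((m : ℤ) + 1) * Real.sin (Real.pi * r) / (Real.pi * (r - (m + 1))) := by
      rw [sinc_pi_mul_sub_int]
      · push_cast; ring
      · push_cast; exact sub_ne_zero.1 n1
    have e2 : Real.sinc (Real.pi * (r - ((-((m : ℤ) + 1) : ℤ) : ℝ))) =
        (-1) ^ ((m : ℤ) + 1) * Real.sin (Real.pi * r) / (Real.pi * (r + (m + 1))) := by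
      rw [sinc_pi_mul_sub_int]
      · rw [zpow_neg, ← inv_zpow, inv_neg, inv_one]
        push_cast; ring
      · push_cast; intro h; exact n2 (by linarith)
    have c1 : Real.cos (((m : ℝ) + 1) * (θ + Real.pi)) =
        (-1) ^ ((m : ℤ) + 1) * Real.cos (((m : ℝ) + 1) * θ) := by
      have := Real.cos_add_int_mul_pi (((m : ℝ) + 1) * θ) (m + 1)
      rw [← this]; push_cast; ring_nf
    have s1 : Real.sin (((m : ℝ) + 1) * (θ + Real.pi)) =
        (-1) ^ ((m : ℤ) + 1) * Real.sin (((m : ℝ) + 1) * θ) := by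
      have := Real.sin_add_int_mul_pi (((m : ℝ) + 1) * θ) (m + 1)
      rw [← this]; push_cast; ring_nf
    rw [e1, e2, c1, s1, cis_eq, cis_eq]
    generalize (-1 : ℝ) ^ ((m : ℤ) + 1) = σ
    have t1 : Real.cos (((-((m : ℤ) + 1) : ℤ) : ℝ) * θ) = Real.cos (((m : ℝ) + 1) * θ) := by
      rw [← Real.cos_neg]; push_cast; ring_nf
    have t2 : Real.sin (((-((m : ℤ) + 1) : ℤ) : ℝ) * θ) = -Real.sin (((m : ℝ) + 1) * θ) := by
      rw [← Real.sin_neg]; push_cast; ring_nf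
    have t3 : ((((m : ℤ) + 1 : ℤ) : ℝ)) = (m : ℝ) + 1 := by push_cast; ring
    rw [t1, t2, t3]
    generalize Real.cos (((m : ℝ) + 1) * θ) = C
    generalize Real.sin (((m : ℝ) + 1) * θ) = D
    generalize Real.sin (Real.pi * r) = s
    have hpi := Real.pi_ne_zero
    have h1 : σ * s / (Real.pi * (r - (m + 1))) * C + σ * s / (Real.pi * (r + (m + 1))) * C =
        -(s / Real.pi) * (2 * r * (σ * C) / (((m : ℝ) + 1) ^ 2 - r ^ 2)) := by
      field_simp
      ring
    have h2 : σ * s / (Real.pi * (r - (m + 1))) * D - σ * s / (Real.pi * (r + (m + 1))) * D =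
        -(s / Real.pi) * (2 * ((m : ℝ) + 1) * (σ * D) / (((m : ℝ) + 1) ^ 2 - r ^ 2)) := by
      field_simp
      ring
    generalize σ * s / (Real.pi * (r - (m + 1))) = α at h1 h2 ⊢
    generalize σ * s / (Real.pi * (r + (m + 1))) = β at h1 h2 ⊢
    generalize 2 * r * (σ * C) / (((m : ℝ) + 1) ^ 2 - r ^ 2) = γ at h1 ⊢
    generalize 2 * ((m : ℝ) + 1) * (σ * D) / (((m : ℝ) + 1) ^ 2 - r ^ 2) = κ at h2 ⊢
    have h1' := congrArg Complex.ofReal h1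
    have h2' := congrArg Complex.ofReal h2
    rw [Complex.ofReal_add, Complex.ofReal_add, Complex.ofReal_neg]
    rw [Complex.ofReal_add, Complex.ofReal_mul, Complex.ofReal_mul, Complex.ofReal_mul,
      Complex.ofReal_neg] at h1'
    rw [Complex.ofReal_sub, Complex.ofReal_mul, Complex.ofReal_mul, Complex.ofReal_mul,
      Complex.ofReal_neg] at h2'
    linear_combination h1' + Complex.I * h2'

theorem norm_sum_symmetric_sinc_le {r : ℝ} (hr : |r| ≤ 1 / 2) (θ : ℝ) (m : ℕ) :
    ‖∑ k ∈ Finset.Icc (-(m : ℤ)) (m : ℤ), (Real.sinc (Real.pi * (r - k)) : ℂ) * cis (k * θ)‖ ≤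
      1 + |Real.sin (Real.pi * r)| / Real.pi * (2 + 2 * Si Real.pi) := by
  have hr2 : r ^ 2 ≤ 1 / 4 := by
    have := sq_le_sq' (abs_le.1 hr).1 (abs_le.1 hr).2
    linarith
  have hden : ∀ j : ℕ, 0 < ((j : ℝ) + 1) ^ 2 - 1 / 4 := fun j => by
    have : (0 : ℝ) ≤ j := j.cast_nonneg
    nlinarith
  have hden' : ∀ j : ℕ, ((j : ℝ) + 1) ^ 2 - 1 / 4 ≤ ((j : ℝ) + 1) ^ 2 - r ^ 2 := fun j => by
    linarith
  rw [sum_symmetric_sinc_eq hr]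
  set A := ∑ j ∈ Finset.range m, 2 * r * Real.cos (((j : ℝ) + 1) * (θ + Real.pi)) /
    (((j : ℝ) + 1) ^ 2 - r ^ 2) with hA
  set B := ∑ j ∈ Finset.range m, 2 * ((j : ℝ) + 1) * Real.sin (((j : ℝ) + 1) * (θ + Real.pi)) /
    (((j : ℝ) + 1) ^ 2 - r ^ 2) with hB
  have hAle : |A| ≤ 2 := by
    refine (Finset.abs_sum_le_sum_abs _ _).trans
      ((Finset.sum_le_sum fun j _ => ?_).trans (sum_inv_sq_sub_quarter_le m))
    rw [abs_div, abs_of_pos ((hden j).trans_le (hden' j))]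
    refine div_le_div₀ zero_le_one ?_ (hden j) (hden' j)
    rw [abs_mul, abs_mul, abs_two]
    nlinarith [Real.abs_cos_le_one (((j : ℝ) + 1) * (θ + Real.pi)), abs_nonneg r,
      abs_nonneg (Real.cos (((j : ℝ) + 1) * (θ + Real.pi)))]
  have hBle : |B| ≤ 2 * Si Real.pi + 1 := by
    -- With `J = j + 1`, dropping `r²` from the denominator changes a coefficient by `2r²/(J(J² -
    -- r²))`, at most half of `1/(J² - 1/4)`.
    have hdiff : |B - 2 * sineSum m (θ + Real.pi)| ≤ 1 := by
      rw [hB, sineSum, Finset.mul_sum, ← Finset.sum_sub_distrib]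
      have h2 := sum_inv_sq_sub_quarter_le m
      refine (Finset.abs_sum_le_sum_abs _ _).trans
        ((Finset.sum_le_sum (g := fun j : ℕ => 1 / 2 * (1 / (((j : ℝ) + 1) ^ 2 - 1 / 4)))
          fun j _ => ?_).trans ?_)
      · have hj : (0 : ℝ) ≤ j := j.cast_nonneg
        have hj1 : (0 : ℝ) < (j : ℝ) + 1 := by positivity
        have hd := (hden j).trans_le (hden' j)
        have e : 2 * ((j : ℝ) + 1) * Real.sin (((j : ℝ) + 1) * (θ + Real.pi)) /
              (((j : ℝ) + 1) ^ 2 - r ^ 2) -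
            2 * (Real.sin (((j : ℝ) + 1) * (θ + Real.pi)) / ((j : ℝ) + 1)) =
            (2 * r ^ 2 * Real.sin (((j : ℝ) + 1) * (θ + Real.pi)) / ((j : ℝ) + 1)) /
              (((j : ℝ) + 1) ^ 2 - r ^ 2) := by
          field_simp
          ring
        rw [e, abs_div, abs_of_pos hd, ← mul_div_assoc, mul_one]
        refine div_le_div₀ (by norm_num) ?_ (hden j) (hden' j)
        rw [abs_div, abs_of_pos hj1, div_le_iff₀ hj1, abs_mul, abs_of_nonneg (by positivity)]
        nlinarith [Real.abs_sin_le_one (((j : ℝ) + 1) * (θ + Real.pi)), sq_nonneg r,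
          abs_nonneg (Real.sin (((j : ℝ) + 1) * (θ + Real.pi)))]
      · rw [← Finset.mul_sum]
        linarith
    have h1 := abs_sineSum_le m (θ + Real.pi)
    rw [abs_le] at *
    constructor <;> linarith [h1.1, h1.2, hdiff.1, hdiff.2]
  have hAB : ‖(A : ℂ) + (B : ℂ) * Complex.I‖ ≤ 2 + 2 * Si Real.pi := by
    have hSi := one_le_Si_pi
    rw [Complex.norm_add_mul_I]
    -- The triangle inequality would give `3 + 2 Si π`; adding squares saves the extra `1`, because
    -- `4 + (2 Si π + 1)² ≤ (2 + 2 Si π)²` when `Si π ≥ 1/4`.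
    refine Real.sqrt_le_iff.2 ⟨by linarith, ?_⟩
    have h1 := sq_le_sq' (by linarith [(abs_le.1 hAle).1]) (abs_le.1 hAle).2
    have h2 := sq_le_sq' (by linarith [(abs_le.1 hBle).1]) (abs_le.1 hBle).2
    nlinarith
  refine (norm_sub_le _ _).trans (add_le_add ?_ ?_)
  · rw [Complex.norm_real]
    exact Real.abs_sinc_le_one _
  · rw [norm_mul, Complex.norm_real, Real.norm_eq_abs, abs_div, abs_of_pos Real.pi_pos]
    exact mul_le_mul_of_nonneg_left hAB (by positivity)

theorem norm_sum_sinc_le {τ : ℝ} {n : ℕ} (hτ0 : 0 ≤ τ) (hτn : τ < n) (θ : ℝ) :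
    ‖∑ k ∈ Finset.Icc (-(n : ℤ)) (n : ℤ), (Real.sinc (Real.pi * (τ - k)) : ℂ) * cis (k * θ)‖ ≤
      1 + 2 * |Real.sin (Real.pi * τ)| / Real.pi *
        (1 + Si Real.pi + (τ + 0.5) / (n - τ)) := by
  have hpi := Real.pi_pos
  -- `a` is the integer nearest `τ`. The window `[-n, n]` splits into `[a - m, a + m]`, symmetric
  -- about `a` with `m = n - a`, and the `2a ≤ 2(τ + 1/2)` indices to its left, each at distance at
  -- least `n - τ` from `τ`.
  obtain ⟨a, ha⟩ : ∃ a : ℕ, |τ - a| ≤ 1 / 2 := by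
    have h := abs_sub_round τ
    have h0 : 0 ≤ round τ := by
      rw [round_eq]
      exact Int.floor_nonneg.2 (by linarith)
    refine ⟨(round τ).toNat, ?_⟩
    have : (((round τ).toNat : ℤ) : ℝ) = (round τ : ℝ) := by rw [Int.toNat_of_nonneg h0]
    rw [Int.cast_natCast] at this
    rwa [this]
  obtain ⟨ha1, ha2⟩ := abs_le.1 ha
  have han : a ≤ n := by
    have : (a : ℝ) < (n : ℝ) + 1 := by linarith
    exact Nat.lt_succ_iff.1 (by exact_mod_cast this)
  obtain ⟨m, rfl⟩ := Nat.exists_eq_add_of_le han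
  have hsin : |Real.sin (Real.pi * (τ - a))| = |Real.sin (Real.pi * τ)| := by
    rw [mul_sub, mul_comm Real.pi (a : ℝ), Real.sin_sub_nat_mul_pi, abs_mul, abs_pow]
    simp
  push_cast at hτn ⊢
  have hset : Finset.Icc (-((a : ℤ) + m)) ((a : ℤ) + m) =
      Finset.Ico (-((a : ℤ) + m)) ((a : ℤ) - m) ∪ Finset.Icc ((a : ℤ) - m) ((a : ℤ) + m) := by
    ext k
    simp only [Finset.mem_Icc, Finset.mem_union, Finset.mem_Ico]
    omega
  rw [hset, Finset.sum_union (by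
    rw [Finset.disjoint_left]
    intro k
    simp only [Finset.mem_Icc, Finset.mem_Ico]
    omega)]
  have hfar : ‖∑ k ∈ Finset.Ico (-((a : ℤ) + m)) ((a : ℤ) - m),
      (Real.sinc (Real.pi * (τ - k)) : ℂ) * cis (k * θ)‖ ≤
      2 * |Real.sin (Real.pi * τ)| / Real.pi * ((τ + 0.5) / (a + m - τ)) := by
    have hterm : ∀ k ∈ Finset.Ico (-((a : ℤ) + m)) ((a : ℤ) - m),
        ‖(Real.sinc (Real.pi * (τ - k)) : ℂ) * cis (k * θ)‖ ≤
          |Real.sin (Real.pi * τ)| / (Real.pi * (a + m - τ)) := by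
      intro k hk
      have hk2 : (k : ℝ) ≤ (a : ℝ) - m - 1 := by
        have := (Finset.mem_Ico.1 hk).2
        have : k ≤ (a : ℤ) - m - 1 := by omega
        exact_mod_cast this
      have hk3 : (a : ℝ) + m - τ ≤ τ - k := by linarith
      have hne : τ ≠ k := by intro h; linarith
      rw [norm_mul, norm_cis, mul_one, Complex.norm_real, Real.norm_eq_abs,
        abs_sinc_pi_mul_sub_int hne, abs_of_pos (a := τ - k) (by linarith)]
      have : 0 < (a : ℝ) + m - τ := by linarith
      gcongr
    refine (norm_sum_le_of_le _ hterm).trans ?_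
    rw [Finset.sum_const, Int.card_Ico, nsmul_eq_mul]
    have hc : (((a : ℤ) - m - (-((a : ℤ) + m))).toNat : ℝ) = 2 * a := by
      have : ((a : ℤ) - m - (-((a : ℤ) + m))).toNat = 2 * a := by omega
      rw [this]; push_cast; ring
    rw [hc]
    have hd : 0 < (a : ℝ) + m - τ := by linarith
    have e : 2 * |Real.sin (Real.pi * τ)| / Real.pi * ((τ + 0.5) / (a + m - τ)) =
        2 * (τ + 0.5) * (|Real.sin (Real.pi * τ)| / (Real.pi * (a + m - τ))) := by
      field_simp
    rw [e]
    refine mul_le_mul_of_nonneg_right ?_ (by positivity)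
    norm_num at ha1 ⊢
    linarith
  have hnear : ‖∑ k ∈ Finset.Icc ((a : ℤ) - m) ((a : ℤ) + m),
      (Real.sinc (Real.pi * (τ - k)) : ℂ) * cis (k * θ)‖ ≤
      1 + |Real.sin (Real.pi * τ)| / Real.pi * (2 + 2 * Si Real.pi) := by
    have e : ∑ k ∈ Finset.Icc ((a : ℤ) - m) ((a : ℤ) + m),
        (Real.sinc (Real.pi * (τ - k)) : ℂ) * cis (k * θ) =
        cis (a * θ) * ∑ k ∈ Finset.Icc (-(m : ℤ)) (m : ℤ),
          (Real.sinc (Real.pi * (τ - a - k)) : ℂ) * cis (k * θ) := by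
      rw [Finset.mul_sum]
      refine Finset.sum_nbij' (fun k => k - a) (fun k => k + a) ?_ ?_ ?_ ?_ ?_
      · intro k; simp only [Finset.mem_Icc]; omega
      · intro k; simp only [Finset.mem_Icc]; omega
      · intro k _; ring
      · intro k _; ring
      · intro k _
        rw [mul_left_comm, ← cis_add]
        push_cast
        ring_nf
    rw [e, norm_mul, norm_cis, one_mul, ← hsin]
    exact norm_sum_symmetric_sinc_le ha θ m
  refine (norm_add_le _ _).trans ((add_le_add hfar hnear).trans (le_of_eq ?_))
  ring

/-- The error of the truncated cardinal series is bounded uniformly in the frequency. -/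
theorem norm_cardinalError_le {τ : ℝ} {n : ℕ} (hτ0 : 0 ≤ τ) (hτn : τ < n) (θ : ℝ) :
    ‖cardinalError τ θ n‖ ≤ 2 + 2 * |Real.sin (Real.pi * τ)| / Real.pi *
        (1 + Si Real.pi + (τ + 0.5) / (n - τ)) := by
  refine (norm_sub_le _ _).trans ?_
  rw [norm_cis]
  linarith [norm_sum_sinc_le hτ0 hτn θ]

/-! ### The cardinal series of an exponential of low frequency -/

theorem integral_cis_mul (μ : ℝ) :
    ∫ x in (-Real.pi)..Real.pi, cis (μ * x) = ((2 * Real.pi * Real.sinc (Real.pi * μ) : ℝ) : ℂ) := by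
  rcases eq_or_ne μ 0 with rfl | hμ
  · simp [cis, two_mul]
  · rw [intervalIntegral.integral_comp_mul_left cis hμ]
    have h := integral_exp_mul_I_eq_sinc (μ * Real.pi)
    have h' : ∫ x in (μ * -Real.pi)..(μ * Real.pi), cis x =
        2 * ((μ * Real.pi : ℝ) * Real.sinc (μ * Real.pi)) := by
      rw [mul_neg]
      simpa [cis, mul_assoc] using h
    rw [h', Complex.real_smul, mul_comm Real.pi μ]
    push_cast
    have : (μ : ℂ) ≠ 0 := by exact_mod_cast hμ
    field_simp

/-- The sum of two consecutive coefficients of the cardinal series. -/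
noncomputable def sincPair (τ : ℝ) (k : ℤ) : ℝ :=
  Real.sinc (Real.pi * (τ - k)) + Real.sinc (Real.pi * (τ - (k - 1)))

/-- The two coefficients carry opposite signs `(-1)^k` and `(-1)^(k-1)`, so their sum is a
difference of neighbouring reciprocals, ready to telescope. -/
theorem abs_sincPair_le {τ : ℝ} {k : ℤ} (h : τ ≠ k) (h' : τ ≠ k - 1) :
    |sincPair τ k| ≤ 1 / Real.pi * |1 / (τ - k) - 1 / (τ - (k - 1))| := by
  have hpi := Real.pi_pos
  have n1 : τ - k ≠ 0 := sub_ne_zero.2 h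
  have n2 : τ - (k - 1) ≠ 0 := sub_ne_zero.2 h'
  have e1 := sinc_pi_mul_sub_int h
  have e2 := sinc_pi_mul_sub_int (τ := τ) (k := k - 1) (by push_cast; exact h')
  rw [zpow_sub_one₀ (by norm_num)] at e2
  push_cast at e2
  have e : sincPair τ k = (-1) ^ k * Real.sin (Real.pi * τ) *
      (1 / Real.pi * (1 / (τ - k) - 1 / (τ - (k - 1)))) := by
    rw [sincPair, e1, e2]
    generalize (-1 : ℝ) ^ k = σ
    field_simp
    ring
  rw [e, abs_mul, abs_mul, abs_neg_one_zpow, one_mul, abs_mul, abs_of_pos (by positivity : 0 < 1 / Real.pi)]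
  exact mul_le_of_le_one_left (by positivity) (Real.abs_sin_le_one _)

theorem abs_sincPair_le_of_lt {τ : ℝ} {k : ℤ} (h : τ < k - 1) :
    |sincPair τ k| ≤ 1 / Real.pi * (1 / (k - 1 - τ) - 1 / (k - τ)) := by
  refine (abs_sincPair_le (by intro h; linarith) h.ne).trans (le_of_eq ?_)
  have h1 : 0 < (k : ℝ) - 1 - τ := by linarith
  have e : 1 / (τ - k) - 1 / (τ - (k - 1)) = 1 / (k - 1 - τ) - 1 / (k - τ) := by
    rw [← neg_sub (k : ℝ) τ, ← neg_sub ((k : ℝ) - 1) τ]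
    simp only [one_div, inv_neg]
    ring
  rw [e, abs_of_nonneg]
  exact sub_nonneg.2 (one_div_le_one_div_of_le h1 (by linarith))

theorem abs_sincPair_le_of_gt {τ : ℝ} {k : ℤ} (h : k < τ) :
    |sincPair τ k| ≤ 1 / Real.pi * (1 / (τ - k) - 1 / (τ - k + 1)) := by
  refine (abs_sincPair_le h.ne' (by intro h; linarith)).trans (le_of_eq ?_)
  have e : τ - (k - 1) = τ - k + 1 := by ring
  rw [e, abs_of_nonneg]
  exact sub_nonneg.2 (one_div_le_one_div_of_le (by linarith) (by linarith))

theorem summable_sincPair (τ : ℝ) : Summable (sincPair τ) := by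
  have tele : ∀ (g : ℕ → ℝ) (u : ℕ → ℝ) (_ : ∀ j, |g j| ≤ 1 / Real.pi * (u j - u (j + 1)))
      (_ : ∀ j, 0 ≤ u j), Summable g := by
    intro g u hg hu
    refine Summable.of_abs (summable_of_sum_range_le (c := 1 / Real.pi * u 0)
      (fun _ => abs_nonneg _) fun n => ?_)
    refine (Finset.sum_le_sum fun j _ => hg j).trans ?_
    rw [← Finset.mul_sum, Finset.sum_range_sub']
    have : 0 ≤ 1 / Real.pi := by positivity
    exact mul_le_mul_of_nonneg_left (by linarith [hu n]) this
  obtain ⟨n, hn⟩ := exists_nat_gt |τ|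
  obtain ⟨hn1, hn2⟩ := abs_lt.1 hn
  refine summable_int_iff_summable_nat_and_neg.2 ⟨?_, ?_⟩
  · rw [← summable_nat_add_iff (n + 1)]
    refine tele _ (fun j => 1 / (n + j - τ)) (fun j => ?_) fun j => ?_
    · have hj : (0 : ℝ) ≤ j := j.cast_nonneg
      refine (abs_sincPair_le_of_lt (by push_cast; linarith)).trans (le_of_eq ?_)
      push_cast
      ring_nf
    · have hj : (0 : ℝ) ≤ j := j.cast_nonneg
      exact one_div_nonneg.2 (by linarith)
  · rw [← summable_nat_add_iff n]
    refine tele _ (fun j => 1 / (n + j + τ)) (fun j => ?_) fun j => ?_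
    · have hj : (0 : ℝ) ≤ j := j.cast_nonneg
      refine (abs_sincPair_le_of_gt (by push_cast; linarith)).trans (le_of_eq ?_)
      push_cast
      ring_nf
    · have hj : (0 : ℝ) ≤ j := j.cast_nonneg
      exact one_div_nonneg.2 (by linarith)

/-- The pairs are the Fourier coefficients of the periodic extension of `(1 + cis x) * cis (τ x)`.
Being summable, they force the Fourier series to converge pointwise to this continuous function. -/
theorem hasSum_sincPair_mul_cis (τ : ℝ) {θ : ℝ} (hθ : θ ∈ Set.Ico (-Real.pi) Real.pi) :
    HasSum (fun k : ℤ => (sincPair τ k : ℂ) * cis (k * θ)) ((1 + cis θ) * cis (τ * θ)) := by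
  have hpi := Real.pi_pos
  have : Fact (0 < 2 * Real.pi) := ⟨by positivity⟩
  set g : ℝ → ℂ := fun x => (1 + cis x) * cis (τ * x) with hg
  have hgc : Continuous g :=
    (continuous_const.add continuous_cis).mul (continuous_cis.comp (by fun_prop))
  have hend : -Real.pi + 2 * Real.pi = Real.pi := by ring
  have hcis : cis Real.pi = -1 := by simp [cis_eq]
  have hcis' : cis (-Real.pi) = -1 := by simp [cis_eq]
  -- The factor `1 + cis x` vanishes at `±π`, so the periodic extension has no jump at the seam,
  -- unlike that of `cis (τ x)` alone.
  let G : C(AddCircle (2 * Real.pi), ℂ) :=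
    ⟨AddCircle.liftIco (2 * Real.pi) (-Real.pi) g,
      AddCircle.liftIco_continuous (by simp [hg, hend, hcis, hcis']) hgc.continuousOn⟩
  have hfour : ∀ (k : ℤ) (x : ℝ), fourier k (x : AddCircle (2 * Real.pi)) = cis (k * x) := by
    intro k x
    rw [fourier_coe_apply, cis]
    congr 1
    push_cast
    have : (Real.pi : ℂ) ≠ 0 := by exact_mod_cast hpi.ne'
    field_simp
  have hcoef : ∀ k : ℤ, fourierCoeff G k = (sincPair τ k : ℂ) := by
    intro k
    have h1 : fourierCoeff G k = fourierCoeff (AddCircle.liftIco (2 * Real.pi) (-Real.pi) g) k :=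
      rfl
    rw [h1, fourierCoeff_eq_intervalIntegral _ _ (-Real.pi)]
    have h2 : ∫ x in (-Real.pi)..(-Real.pi + 2 * Real.pi),
        fourier (-k) (x : AddCircle (2 * Real.pi)) •
          AddCircle.liftIco (2 * Real.pi) (-Real.pi) g x =
        ∫ x in (-Real.pi)..Real.pi, (cis ((τ - k) * x) + cis ((τ - (k - 1)) * x)) := by
      rw [hend]
      refine intervalIntegral.integral_congr_Ioo_of_le (by linarith) fun x hx => ?_
      rw [hfour, AddCircle.liftIco_coe_apply ⟨hx.1.le, by rw [hend]; exact hx.2⟩, hg, smul_eq_mul]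
      simp only
      rw [add_mul, one_mul, mul_add, ← cis_add, ← cis_add, ← cis_add]
      push_cast
      ring_nf
    have hi : ∀ μ : ℝ, IntervalIntegrable (fun x => cis (μ * x)) volume (-Real.pi) Real.pi :=
      fun μ => (continuous_cis.comp (by fun_prop)).intervalIntegrable _ _
    rw [h2, intervalIntegral.integral_add (hi _) (hi _), integral_cis_mul, integral_cis_mul,
      sincPair, ← Complex.ofReal_add, Complex.real_smul, ← Complex.ofReal_mul]
    congr 1
    field_simp
  have hsum : Summable (fourierCoeff G) := by
    have : (fourierCoeff G) = fun k => (sincPair τ k : ℂ) := funext hcoef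
    rw [this]
    exact Complex.ofRealCLM.summable (summable_sincPair τ)
  have h := has_pointwise_sum_fourier_series_of_summable hsum (θ : AddCircle (2 * Real.pi))
  have hG : G (θ : AddCircle (2 * Real.pi)) = (1 + cis θ) * cis (τ * θ) :=
    AddCircle.liftIco_coe_apply (f := g) (by rwa [hend])
  rw [hG] at h
  simpa only [hcoef, hfour, smul_eq_mul] using h

/-- Summation by parts: shifting one copy of the window by one index leaves only two boundary terms.
-/
theorem sum_sincPair_mul_cis (τ θ : ℝ) (n : ℕ) :
    ∑ k ∈ Finset.Icc (-(n : ℤ)) (n : ℤ), (sincPair τ k : ℂ) * cis (k * θ) =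
      (1 + cis θ) * ∑ k ∈ Finset.Icc (-(n : ℤ)) (n : ℤ),
          (Real.sinc (Real.pi * (τ - k)) : ℂ) * cis (k * θ)
        - Real.sinc (Real.pi * (τ - n)) * cis ((n + 1) * θ)
        + Real.sinc (Real.pi * (τ + n + 1)) * cis (-n * θ) := by
  induction n with
  | zero =>
    simp [sincPair, cis]
    ring_nf
  | succ n ih =>
    have a1 : cis ((((n + 1 : ℕ) : ℝ) + 1) * θ) = cis θ * cis ((n + 1) * θ) := by
      rw [← cis_add]; push_cast; ring_nf
    have a2 : cis (-n * θ) = cis θ * cis (-((n + 1 : ℕ) : ℝ) * θ) := by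
      rw [← cis_add]; push_cast; ring_nf
    rw [sum_Icc_neg_succ, sum_Icc_neg_succ, ih, a1, a2, sincPair, sincPair]
    generalize ∑ k ∈ Finset.Icc (-(n : ℤ)) (n : ℤ),
      (Real.sinc (Real.pi * (τ - k)) : ℂ) * cis (k * θ) = Q
    push_cast
    ring_nf

theorem norm_sum_sincPair_sub_le {τ : ℝ} {n : ℕ} (hτ0 : 0 ≤ τ) (hτn : τ < n) (θ : ℝ) (N : ℕ) :
    ‖∑ k ∈ Finset.Icc (-((n + N : ℕ) : ℤ)) ((n + N : ℕ) : ℤ), (sincPair τ k : ℂ) * cis (k * θ) -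
      ∑ k ∈ Finset.Icc (-(n : ℤ)) (n : ℤ), (sincPair τ k : ℂ) * cis (k * θ)‖ ≤
      1 / Real.pi * ((1 / (n - τ) - 1 / (n + N - τ)) +
        (1 / (τ + n + 1) - 1 / (τ + n + N + 1))) := by
  induction N with
  | zero => simp
  | succ N ih =>
    rw [← Nat.add_assoc, sum_Icc_neg_succ, add_sub_right_comm]
    refine (norm_add_le _ _).trans ((add_le_add ih (norm_add_le _ _)).trans ?_)
    rw [norm_mul, norm_mul, norm_cis, norm_cis, Complex.norm_real, Complex.norm_real,
      Real.norm_eq_abs, Real.norm_eq_abs, mul_one, mul_one]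
    have hN : (0 : ℝ) ≤ N := N.cast_nonneg
    have h1 := abs_sincPair_le_of_lt (τ := τ) (k := ((n + N : ℕ) : ℤ) + 1)
      (by push_cast; linarith)
    have h2 := abs_sincPair_le_of_gt (τ := τ) (k := -(((n + N : ℕ) : ℤ) + 1))
      (by push_cast; linarith)
    refine (add_le_add le_rfl (add_le_add h1 h2)).trans (le_of_eq ?_)
    push_cast
    ring_nf

theorem norm_one_add_cis (θ : ℝ) : ‖1 + cis θ‖ = 2 * |Real.cos (θ / 2)| := by
  have h : 1 + cis θ = cis (θ / 2) * ((2 * Real.cos (θ / 2) : ℝ) : ℂ) := by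
    have e : cis θ = cis (θ / 2) * cis (θ / 2) := by rw [← cis_add]; ring_nf
    have e' : (1 : ℂ) = cis (θ / 2) * cis (-(θ / 2)) := by rw [← cis_add]; simp [cis]
    rw [e, e', ← mul_add]
    congr 1
    rw [cis_eq, cis_eq, Real.cos_neg, Real.sin_neg]
    push_cast
    ring
  rw [h, norm_mul, norm_cis, one_mul, Complex.norm_real, Real.norm_eq_abs, abs_mul, abs_two]

/-- The error of the truncated cardinal series of an exponential of low frequency. -/
theorem norm_cardinalError_le_of_abs_lt {τ : ℝ} {n : ℕ} (hτ0 : 0 ≤ τ) (hτn : τ < n) {θ : ℝ}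
    (hθ : |θ| < Real.pi) :
    ‖cardinalError τ θ n‖ ≤
      (1 / (n - τ) + 1 / (τ + n + 1)) / (Real.pi * Real.cos (θ / 2)) := by
  have hpi := Real.pi_pos
  obtain ⟨hθ1, hθ2⟩ := abs_lt.1 hθ
  have hcos : 0 < Real.cos (θ / 2) := Real.cos_pos_of_mem_Ioo ⟨by linarith, by linarith⟩
  have hnτ : 0 < (n : ℝ) - τ := by linarith
  have hn1 : 0 < τ + n + 1 := by positivity
  have hlim : ‖(1 + cis θ) * cis (τ * θ) -
      ∑ k ∈ Finset.Icc (-(n : ℤ)) (n : ℤ), (sincPair τ k : ℂ) * cis (k * θ)‖ ≤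
      1 / Real.pi * (1 / (n - τ) + 1 / (τ + n + 1)) := by
    have ht : Tendsto (fun N : ℕ => ∑ k ∈ Finset.Icc (-((n + N : ℕ) : ℤ)) ((n + N : ℕ) : ℤ),
        (sincPair τ k : ℂ) * cis (k * θ)) atTop (𝓝 ((1 + cis θ) * cis (τ * θ))) := by
      have h0 := (hasSum_sincPair_mul_cis τ (θ := θ) ⟨hθ1.le, hθ2⟩)
      have h1 : Tendsto (fun N : ℕ => ((n + N : ℕ) : ℤ)) atTop atTop :=
        tendsto_natCast_atTop_atTop.comp (tendsto_add_atTop_nat n |>.congr fun N => add_comm _ _)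
      exact h0.comp (Finset.tendsto_Icc_neg_atTop_atTop.comp h1)
    refine le_of_tendsto (ht.sub_const _).norm (Eventually.of_forall fun N => ?_)
    refine (norm_sum_sincPair_sub_le hτ0 hτn θ N).trans ?_
    have hN : (0 : ℝ) ≤ N := N.cast_nonneg
    have i1 : 0 ≤ 1 / ((n : ℝ) + N - τ) := one_div_nonneg.2 (by linarith)
    have i2 : 0 ≤ 1 / (τ + n + N + 1) := by positivity
    exact mul_le_mul_of_nonneg_left (by linarith) (by positivity)
  have b1 : |Real.sinc (Real.pi * (τ - n))| ≤ 1 / Real.pi * (1 / (n - τ)) := by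
    have h := abs_sinc_pi_mul_sub_int_le (τ := τ) (k := n) (by push_cast; exact hτn.ne)
    push_cast at h
    rw [abs_sub_comm, abs_of_pos hnτ] at h
    rwa [one_div_mul_one_div]
  have b2 : |Real.sinc (Real.pi * (τ + n + 1))| ≤ 1 / Real.pi * (1 / (τ + n + 1)) := by
    have h := abs_sinc_pi_mul_sub_int_le (τ := τ) (k := -((n : ℤ) + 1))
      (by push_cast; intro h; linarith)
    have e : τ - ((-((n : ℤ) + 1) : ℤ) : ℝ) = τ + n + 1 := by push_cast; ring
    rw [e, abs_of_pos hn1] at h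
    rwa [one_div_mul_one_div]
  have hmul : (1 + cis θ) * cardinalError τ θ n =
      ((1 + cis θ) * cis (τ * θ) -
        ∑ k ∈ Finset.Icc (-(n : ℤ)) (n : ℤ), (sincPair τ k : ℂ) * cis (k * θ))
        - Real.sinc (Real.pi * (τ - n)) * cis ((n + 1) * θ)
        + Real.sinc (Real.pi * (τ + n + 1)) * cis (-n * θ) := by
    rw [sum_sincPair_mul_cis, cardinalError]
    ring
  have hnorm : ‖(1 + cis θ) * cardinalError τ θ n‖ ≤
      2 * (1 / Real.pi * (1 / (n - τ) + 1 / (τ + n + 1))) := by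
    rw [hmul]
    -- The tail of the paired series and the two boundary terms each contribute one copy of the
    -- bound; the factor `2` cancels against `‖1 + cis θ‖ = 2 cos(θ/2)`.
    refine (norm_add_le _ _).trans ((add_le_add ((norm_sub_le _ _).trans
      (add_le_add hlim le_rfl)) le_rfl).trans ?_)
    rw [norm_mul, norm_mul, norm_cis, norm_cis, Complex.norm_real, Complex.norm_real,
      Real.norm_eq_abs, Real.norm_eq_abs, mul_one, mul_one]
    linarith
  rw [norm_mul, norm_one_add_cis, abs_of_pos hcos] at hnorm
  rw [le_div_iff₀ (by positivity)]
  have h2 := mul_le_mul_of_nonneg_left hnorm hpi.le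
  have e : Real.pi * (2 * (1 / Real.pi * (1 / (n - τ) + 1 / (τ + n + 1)))) =
      2 * (1 / (n - τ) + 1 / (τ + n + 1)) := by
    field_simp
  rw [e] at h2
  linarith

/-! ### Mean square bound for the truncation error -/

theorem norm_sum_mul_cis_sq {ι : Type*} (s : Finset ι) (c u : ι → ℝ) (x : ℝ) :
    ((‖∑ i ∈ s, (c i : ℂ) * cis (u i * x)‖ ^ 2 : ℝ) : ℂ) =
      ∑ i ∈ s, ∑ j ∈ s, ((c i * c j : ℝ) : ℂ) * cis ((u i - u j) * x) := by
  rw [Complex.ofReal_pow, ← Complex.mul_conj', map_sum, Finset.sum_mul_sum]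
  refine Finset.sum_congr rfl fun i _ => Finset.sum_congr rfl fun j _ => ?_
  have hconj : (starRingEnd ℂ) (cis (u j * x)) = cis (-(u j * x)) := by
    rw [cis_eq, cis_eq, Real.cos_neg, Real.sin_neg]
    simp only [map_add, map_mul, Complex.conj_ofReal, Complex.conj_I, Complex.ofReal_neg, mul_neg,
      neg_mul]
  have h : (u i - u j) * x = u i * x + -(u j * x) := by ring
  rw [map_mul, Complex.conj_ofReal, hconj, h, cis_add]
  push_cast
  ring

theorem integrable_cis_mul (F : Measure ℝ) [IsFiniteMeasure F] (r : ℝ) :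
    Integrable (fun x => cis (r * x)) F := by
  refine (integrable_const (1 : ℝ)).mono'
    (continuous_cis.comp (by fun_prop)).aestronglyMeasurable (Eventually.of_forall fun x => ?_)
  rw [norm_cis]

/-- The coefficients of `X t - X_n t` as a linear combination of values of the process. -/
noncomputable def errorCoef (ω t : ℝ) : Option ℤ → ℝ
  | none => 1
  | some k => -Real.sinc (ω * (t - (k : ℝ) * Real.pi / ω))

/-- The times at which `X t - X_n t` uses the process. -/
noncomputable def errorTime (ω t : ℝ) : Option ℤ → ℝ
  | none => t
  | some k => (k : ℝ) * Real.pi / ω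

theorem sub_truncated_eq_sum {Ω : Type*} {X : ℝ → Ω → ℝ} (ω : ℝ) (n : ℕ) (t : ℝ) (w : Ω) :
    X t w - truncated ω n X t w =
      ∑ i ∈ Finset.insertNone (Finset.Icc (-(n : ℤ)) (n : ℤ)),
        errorCoef ω t i * X (errorTime ω t i) w := by
  rw [Finset.sum_insertNone]
  simp [errorCoef, errorTime, truncated, sub_eq_add_neg]

theorem cardinalError_eq_sum {ω : ℝ} (hω : 0 < ω) (n : ℕ) (t x : ℝ) :
    ∑ i ∈ Finset.insertNone (Finset.Icc (-(n : ℤ)) (n : ℤ)),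
        (errorCoef ω t i : ℂ) * cis (errorTime ω t i * x) =
      cardinalError (ω * t / Real.pi) (Real.pi * x / ω) n := by
  have hpi := Real.pi_ne_zero
  rw [Finset.sum_insertNone, cardinalError, sub_eq_add_neg, ← Finset.sum_neg_distrib]
  congr 1
  · have : ω * t / Real.pi * (Real.pi * x / ω) = t * x := by field_simp
    rw [this]
    simp [errorCoef, errorTime]
  · refine Finset.sum_congr rfl fun k _ => ?_
    have e1 : Real.pi * (ω * t / Real.pi - k) = ω * (t - k * Real.pi / ω) := by
      field_simp
    have e2 : (k : ℝ) * (Real.pi * x / ω) = k * Real.pi / ω * x := by ring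
    rw [e1, e2]
    simp [errorCoef, errorTime]

/-- The lower bound on `n` gives `ωt/π ≤ n√z`, and `√z ≤ (1 + z)/2` replaces the root by the factor
`1 - z` used in `C_n`. -/
theorem sampling_position_lt {ω T z : ℝ} {n : ℕ} (hω : 0 < ω) (hT : 0 < T) (hz0 : 0 < z)
    (hz1 : z < 1) (hn : ω * T / (Real.pi * Real.sqrt z) ≤ (n : ℝ)) {t : ℝ}
    (ht : t ∈ Set.Icc 0 T) :
    0 < n ∧ 0 ≤ ω * t / Real.pi ∧ ω * t / Real.pi < n ∧
      n * (1 - z) / 2 ≤ n - ω * t / Real.pi := by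
  have hpi := Real.pi_pos
  have hsz : 0 < Real.sqrt z := Real.sqrt_pos.2 hz0
  have hn0 : (0 : ℝ) < n := lt_of_lt_of_le (by positivity) hn
  have h1 : ω * t / Real.pi ≤ n * Real.sqrt z := by
    rw [div_le_iff₀ (by positivity)] at hn
    rw [div_le_iff₀ hpi]
    nlinarith [mul_le_mul_of_nonneg_left ht.2 hω.le]
  have h2 : Real.sqrt z ≤ (1 + z) / 2 := by
    nlinarith [Real.sq_sqrt hz0.le, sq_nonneg (Real.sqrt z - 1)]
  have h3 := mul_le_mul_of_nonneg_left h2 hn0.le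
  have h4 := mul_pos hn0 (sub_pos.2 hz1)
  exact ⟨by exact_mod_cast hn0, div_nonneg (mul_nonneg hω.le ht.1) hpi.le, by linarith,
    by linarith⟩

theorem coefD_nonneg {ω : ℝ} {n : ℕ} {t : ℝ} (h0 : 0 ≤ ω * t / Real.pi)
    (hn : ω * t / Real.pi < n) : 0 ≤ coefD ω n t := by
  have hSi := one_le_Si_pi
  have hpi := Real.pi_pos
  have h1 : 0 ≤ (ω * t / Real.pi + 0.5) / ((n : ℝ) - ω * t / Real.pi) :=
    div_nonneg (by positivity) (by linarith)
  have h2 : 0 ≤ 1 + Si Real.pi + (ω * t / Real.pi + 0.5) / ((n : ℝ) - ω * t / Real.pi) := by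
    linarith
  unfold coefD
  positivity

theorem norm_cardinalError_le_coefD {ω : ℝ} {n : ℕ} {t : ℝ} (h0 : 0 ≤ ω * t / Real.pi)
    (hn : ω * t / Real.pi < n) (x : ℝ) :
    ‖cardinalError (ω * t / Real.pi) x n‖ ≤ coefD ω n t := by
  have h := norm_cardinalError_le h0 hn x
  rwa [mul_div_cancel₀ _ Real.pi_ne_zero] at h

theorem norm_cardinalError_le_of_le {ω z Λ : ℝ} {n : ℕ} {t x : ℝ} (hn0 : 0 < n) (hz0 : 0 < z)
    (hz1 : z < 1) (hΛ : 0 < Λ) (hΛω : Λ < ω) (h0 : 0 ≤ ω * t / Real.pi)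
    (hn : n * (1 - z) / 2 ≤ n - ω * t / Real.pi) (hx : |x| ≤ Λ) :
    ‖cardinalError (ω * t / Real.pi) (Real.pi * x / ω) n‖ ≤
      (4 * ω * t / (Real.pi ^ 2 * (1 - z)) +
        4 * (z + 1 + 1 / (n : ℝ)) / (Real.pi * (1 - z) ^ 2 * (1 - Λ / ω))) / n := by
  have hpi := Real.pi_pos
  have hω : 0 < ω := hΛ.trans hΛω
  have hn0' : (0 : ℝ) < n := by exact_mod_cast hn0
  have hz : 0 < 1 - z := by linarith
  have hΛ1 : 0 < 1 - Λ / ω := by rw [sub_pos, div_lt_one hω]; exact hΛω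
  have habs : |Real.pi * x / ω| = Real.pi * (|x| / ω) := by
    rw [abs_div, abs_mul, abs_of_pos hpi, abs_of_pos hω, mul_div_assoc]
  have hxω : |x| / ω ≤ Λ / ω := div_le_div_of_nonneg_right hx hω.le
  have hxω0 : 0 ≤ |x| / ω := by positivity
  have hθ : |Real.pi * x / ω| < Real.pi := by
    rw [habs]
    exact mul_lt_of_lt_one_right hpi (by linarith)
  -- Jordan's inequality in the form `cos y ≥ 1 - 2y/π`, at `y = π|x|/(2ω)`.
  have hcos : 1 - Λ / ω ≤ Real.cos (Real.pi * x / ω / 2) := by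
    rw [← Real.cos_abs, abs_div, abs_two, habs]
    have h := Real.one_sub_mul_le_cos (x := Real.pi * (|x| / ω) / 2) (by positivity) (by
      have : Real.pi * (|x| / ω) ≤ Real.pi * 1 := mul_le_mul_of_nonneg_left (by linarith) hpi.le
      linarith)
    have e : 2 / Real.pi * (Real.pi * (|x| / ω) / 2) = |x| / ω := by
      field_simp
    rw [e] at h
    linarith
  have hpos : 0 < n * (1 - z) / 2 := by positivity
  refine (norm_cardinalError_le_of_abs_lt h0 (by linarith) hθ).trans ?_
  have i1 : 1 / ((n : ℝ) - ω * t / Real.pi) ≤ 2 / (n * (1 - z)) := by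
    refine (one_div_le_one_div_of_le hpos hn).trans (le_of_eq ?_)
    rw [one_div_div]
  have i2 : 1 / (ω * t / Real.pi + n + 1) ≤ 1 / (n * (1 - z)) := by
    refine one_div_le_one_div_of_le (by positivity) ?_
    nlinarith
  have i3 : 1 / ((n : ℝ) - ω * t / Real.pi) + 1 / (ω * t / Real.pi + n + 1) ≤
      3 / (n * (1 - z)) := by
    refine (add_le_add i1 i2).trans (le_of_eq ?_)
    rw [← add_div]; norm_num
  calc (1 / ((n : ℝ) - ω * t / Real.pi) + 1 / (ω * t / Real.pi + n + 1)) /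
        (Real.pi * Real.cos (Real.pi * x / ω / 2))
      ≤ 3 / (n * (1 - z)) / (Real.pi * (1 - Λ / ω)) := by
        refine div_le_div₀ (by positivity) i3 (by positivity) ?_
        exact mul_le_mul_of_nonneg_left hcos hpi.le
    _ = 3 * (1 - z) / (Real.pi * (1 - z) ^ 2 * (1 - Λ / ω)) / n := by
        field_simp
    _ ≤ _ := by
        refine div_le_div_of_nonneg_right ?_ hn0'.le
        have j1 : 0 ≤ 4 * ω * t / (Real.pi ^ 2 * (1 - z)) := by
          have : 4 * ω * t / (Real.pi ^ 2 * (1 - z)) =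
              ω * t / Real.pi * (4 / (Real.pi * (1 - z))) := by
            field_simp
          rw [this]
          positivity
        have j2 : 3 * (1 - z) / (Real.pi * (1 - z) ^ 2 * (1 - Λ / ω)) ≤
            4 * (z + 1 + 1 / (n : ℝ)) / (Real.pi * (1 - z) ^ 2 * (1 - Λ / ω)) := by
          refine div_le_div_of_nonneg_right ?_ (by positivity)
          have : 0 ≤ 1 / (n : ℝ) := by positivity
          linarith
        linarith

theorem boundA_nonneg {B0 : ℝ} (F : Measure ℝ) {ω : ℝ} (z : ℝ) {n : ℕ} {t : ℝ} (Λ : ℝ)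
    (h0 : 0 ≤ ω * t / Real.pi) (hn : ω * t / Real.pi < n) : 0 ≤ boundA B0 F ω z n t Λ :=
  add_nonneg (by positivity) (mul_nonneg (coefD_nonneg h0 hn) (Real.sqrt_nonneg _))

theorem continuous_cardinalError (τ : ℝ) (n : ℕ) : Continuous fun x => cardinalError τ x n := by
  unfold cardinalError
  refine (continuous_cis.comp (by fun_prop)).sub (continuous_finsetSum _ fun k _ => ?_)
  exact continuous_const.mul (continuous_cis.comp (by fun_prop))

section

variable {Ω : Type*} [MeasurableSpace Ω] {P : Measure Ω} {X : ℝ → Ω → ℝ}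

theorem IsStationary.integral_mul_eq_covFun (hstat : IsStationary P X) (s t : ℝ) :
    ∫ w, X s w * X t w ∂P = covFun P X (s - t) := by
  have h := hstat.covariance (s - t) 0 t
  rwa [sub_add_cancel, zero_add] at h

/-- The spectral isometry on finite linear combinations of the values of the process. -/
theorem IsSpectralMeasure.integral_sum_sq {F : Measure ℝ} (hF : IsSpectralMeasure P X F)
    (hstat : IsStationary P X) {ι : Type*} (s : Finset ι) (c u : ι → ℝ) :
    ∫ w, (∑ i ∈ s, c i * X (u i) w) ^ 2 ∂P =
      ∫ x, ‖∑ i ∈ s, (c i : ℂ) * cis (u i * x)‖ ^ 2 ∂F := by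
  obtain ⟨hfin, hB⟩ := hF
  have hcov : ∀ r : ℝ, (covFun P X r : ℂ) = ∫ x : ℝ, cis (r * x) ∂F := by
    intro r
    rw [hB r]
    refine integral_congr_ae (Eventually.of_forall fun x => ?_)
    simp only [cis]
    congr 1
    push_cast
    ring
  have hint : ∀ i j, Integrable (fun w => c i * c j * (X (u i) w * X (u j) w)) P := fun i j =>
    ((hstat.memLp (u i)).integrable_mul (hstat.memLp (u j))).const_mul _
  apply Complex.ofReal_injective
  have hL : ∫ w, (∑ i ∈ s, c i * X (u i) w) ^ 2 ∂P =
      ∑ i ∈ s, ∑ j ∈ s, c i * c j * covFun P X (u i - u j) := by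
    have e : ∀ w, (∑ i ∈ s, c i * X (u i) w) ^ 2 =
        ∑ i ∈ s, ∑ j ∈ s, c i * c j * (X (u i) w * X (u j) w) := by
      intro w
      rw [sq, Finset.sum_mul_sum]
      refine Finset.sum_congr rfl fun i _ => Finset.sum_congr rfl fun j _ => ?_
      ring
    simp_rw [e]
    rw [integral_finsetSum _ fun i _ => integrable_finsetSum _ fun j _ => hint i j]
    refine Finset.sum_congr rfl fun i _ => ?_
    rw [integral_finsetSum _ fun j _ => hint i j]
    refine Finset.sum_congr rfl fun j _ => ?_
    rw [integral_const_mul, hstat.integral_mul_eq_covFun]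
  rw [hL, ← integral_complex_ofReal]
  simp_rw [norm_sum_mul_cis_sq]
  have hint' : ∀ i j, Integrable (fun x => ((c i * c j : ℝ) : ℂ) * cis ((u i - u j) * x)) F :=
    fun i j => (integrable_cis_mul F _).const_mul _
  rw [integral_finsetSum _ fun i _ => integrable_finsetSum _ fun j _ => hint' i j,
    Complex.ofReal_sum]
  refine Finset.sum_congr rfl fun i _ => ?_
  rw [integral_finsetSum _ fun j _ => hint' i j, Complex.ofReal_sum]
  refine Finset.sum_congr rfl fun j _ => ?_
  rw [integral_const_mul, ← hcov, Complex.ofReal_mul]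

theorem IsSpectralMeasure.covFun_zero {F : Measure ℝ} (hF : IsSpectralMeasure P X F) :
    covFun P X 0 = F.real Set.univ := by
  have h := hF.2 0
  have := hF.1
  simp only [Complex.ofReal_zero, mul_zero, zero_mul, Complex.exp_zero, integral_const,
    Complex.real_smul, mul_one] at h
  exact_mod_cast h

theorem integral_sub_truncated_sq_le {F : Measure ℝ} (hF : IsSpectralMeasure P X F)
    (hstat : IsStationary P X) {ω T z Λ : ℝ} {n : ℕ} (hT : 0 < T) (hΛ : 0 < Λ) (hΛω : Λ < ω)
    (hz0 : 0 < z) (hz1 : z < 1) (hn : ω * T / (Real.pi * Real.sqrt z) ≤ (n : ℝ)) {t : ℝ}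
    (ht : t ∈ Set.Icc 0 T) :
    ∫ w, (X t w - truncated ω n X t w) ^ 2 ∂P ≤ boundA (covFun P X 0) F ω z n t Λ ^ 2 := by
  have hω : 0 < ω := hΛ.trans hΛω
  have := hF.1
  obtain ⟨hn0, h0, hlt, h1⟩ := sampling_position_lt hω hT hz0 hz1 hn ht
  have hn0' : (0 : ℝ) < n := by exact_mod_cast hn0
  simp_rw [sub_truncated_eq_sum]
  rw [hF.integral_sum_sq hstat]
  simp_rw [cardinalError_eq_sum hω]
  set E : ℝ → ℝ := fun x => ‖cardinalError (ω * t / Real.pi) (Real.pi * x / ω) n‖ ^ 2 with hE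
  set M : ℝ := (4 * ω * t / (Real.pi ^ 2 * (1 - z)) +
    4 * (z + 1 + 1 / (n : ℝ)) / (Real.pi * (1 - z) ^ 2 * (1 - Λ / ω))) / n with hM
  set D : ℝ := coefD ω n t with hD
  have hEc : Continuous E :=
    ((continuous_cardinalError (ω * t / Real.pi) n).comp
      (by fun_prop : Continuous fun x : ℝ => Real.pi * x / ω)).norm.pow 2
  have hED : ∀ x, E x ≤ D ^ 2 := fun x =>
    pow_le_pow_left₀ (norm_nonneg _) (norm_cardinalError_le_coefD h0 hlt _) 2
  have hEM : ∀ x, |x| ≤ Λ → E x ≤ M ^ 2 := fun x hx =>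
    pow_le_pow_left₀ (norm_nonneg _)
      (norm_cardinalError_le_of_le hn0 hz0 hz1 hΛ hΛω h0 h1 hx) 2
  have hEi : Integrable E F := by
    refine (integrable_const (D ^ 2)).mono' hEc.aestronglyMeasurable
      (Eventually.of_forall fun x => ?_)
    rw [Real.norm_eq_abs, abs_of_nonneg (by positivity)]
    exact hED x
  set K : Set ℝ := {x | Λ < |x|} with hK
  have hKm : MeasurableSet K := measurableSet_lt measurable_const continuous_abs.measurable
  have b1 : ∫ x in K, E x ∂F ≤ D ^ 2 * F.real K := by
    have h := setIntegral_mono_on (μ := F) hEi.integrableOn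
      (integrable_const (D ^ 2)).integrableOn hKm fun x _ => hED x
    simpa [mul_comm] using h
  have b2 : ∫ x in Kᶜ, E x ∂F ≤ M ^ 2 * covFun P X 0 := by
    have h := setIntegral_mono_on (μ := F) hEi.integrableOn
      (integrable_const (M ^ 2)).integrableOn hKm.compl fun x hx => hEM x (not_lt.1 hx)
    refine h.trans ?_
    rw [setIntegral_const, smul_eq_mul, mul_comm, hF.covFun_zero]
    exact mul_le_mul_of_nonneg_left (measureReal_mono (Set.subset_univ _)) (sq_nonneg _)
  rw [← integral_add_compl hKm hEi]
  have hB0 : 0 ≤ covFun P X 0 := by rw [hF.covFun_zero]; exact measureReal_nonneg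
  have hCn : Real.sqrt (coefC (covFun P X 0) ω z n t Λ) ^ 2 = covFun P X 0 * (M * n) ^ 2 := by
    rw [coefC, Real.sq_sqrt (mul_nonneg hB0 (sq_nonneg _)), hM, div_mul_cancel₀ _ hn0'.ne']
  have hDs : Real.sqrt (F.real K) ^ 2 = F.real K := Real.sq_sqrt measureReal_nonneg
  have hcross : 0 ≤ Real.sqrt (coefC (covFun P X 0) ω z n t Λ) / n * (D * Real.sqrt (F.real K)) :=
    mul_nonneg (by positivity) (mul_nonneg (coefD_nonneg h0 hlt) (Real.sqrt_nonneg _))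
  -- The low and high frequency bounds are exactly the two squares in `A_n²`; the cross term is
  -- surplus.
  have e : boundA (covFun P X 0) F ω z n t Λ ^ 2 =
      M ^ 2 * covFun P X 0 + D ^ 2 * F.real K +
        2 * (Real.sqrt (coefC (covFun P X 0) ω z n t Λ) / n * (D * Real.sqrt (F.real K))) := by
    rw [boundA, add_sq, div_pow, hCn, mul_pow D, hDs]
    field_simp
    ring
  rw [e]
  linarith

/-- A determinative constant speaks of distinct times, whereas `t` may coincide with a sampling
point; coefficients of equal times are merged first. -/
theorem IsDeterminativeConstant.tau_sum_le {φ : ℝ → ℝ} {C : ℝ}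
    (hC : IsDeterminativeConstant φ P X C) {ι : Type*} (s : Finset ι) (c u : ι → ℝ) :
    tau φ P (fun w => ∑ i ∈ s, c i * X (u i) w) ≤
      ENNReal.ofReal (C * Real.sqrt (∫ w, (∑ i ∈ s, c i * X (u i) w) ^ 2 ∂P)) := by
  classical
  have h := hC.2 (s.image u) fun x => ∑ i ∈ s with u i = x, c i
  have e : ∀ w, ∑ x ∈ s.image u, (∑ i ∈ s with u i = x, c i) * X x w =
      ∑ i ∈ s, c i * X (u i) w := by
    intro w
    rw [← Finset.sum_fiberwise_of_maps_to (s := s) (t := s.image u) (g := u)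
      (fun i hi => Finset.mem_image_of_mem u hi)]
    refine Finset.sum_congr rfl fun x _ => ?_
    rw [Finset.sum_mul]
    refine Finset.sum_congr rfl fun i hi => ?_
    rw [(Finset.mem_filter.1 hi).2]
  simp_rw [e] at h
  exact h

theorem tau_sub_truncated_le {φ : ℝ → ℝ} {C : ℝ} (hC : IsDeterminativeConstant φ P X C)
    {F : Measure ℝ} (hF : IsSpectralMeasure P X F)
    (hstat : IsStationary P X) {ω T z Λ : ℝ} {n : ℕ} (hT : 0 < T) (hΛ : 0 < Λ) (hΛω : Λ < ω)
    (hz0 : 0 < z) (hz1 : z < 1) (hn : ω * T / (Real.pi * Real.sqrt z) ≤ (n : ℝ)) {t : ℝ}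
    (ht : t ∈ Set.Icc 0 T) :
    tau φ P (fun w => X t w - truncated ω n X t w) ≤
      ENNReal.ofReal (C * boundA (covFun P X 0) F ω z n t Λ) := by
  have hω : 0 < ω := hΛ.trans hΛω
  obtain ⟨hn0, h0, hlt, h1⟩ := sampling_position_lt hω hT hz0 hz1 hn ht
  have h := integral_sub_truncated_sq_le hF hstat hT hΛ hΛω hz0 hz1 hn ht
  have h2 := hC.tau_sum_le (Finset.insertNone (Finset.Icc (-(n : ℤ)) (n : ℤ)))
    (errorCoef ω t) (errorTime ω t)
  simp_rw [← sub_truncated_eq_sum] at h2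
  refine h2.trans (ENNReal.ofReal_le_ofReal (mul_le_mul_of_nonneg_left ?_ hC.1.le))
  exact Real.sqrt_le_iff.2 ⟨boundA_nonneg F z Λ h0 hlt, h⟩

end

/-! ### Orlicz N-functions and exponential moments -/

theorem IsOrliczNFunction.monotoneOn {φ : ℝ → ℝ} (hφ : IsOrliczNFunction φ) :
    MonotoneOn φ (Set.Ici 0) := by
  intro x hx y _ hxy
  have hx' : (0 : ℝ) ≤ x := hx
  have h := hφ.convexOn.le_max_of_mem_Icc (x := -y) (y := y) (z := x) (Set.mem_univ _)
    (Set.mem_univ _) ⟨by linarith, hxy⟩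
  rwa [hφ.even, max_self] at h

theorem IsOrliczNFunction.map_abs {φ : ℝ → ℝ} (hφ : IsOrliczNFunction φ) (x : ℝ) :
    φ |x| = φ x := by
  rcases abs_choice x with h | h <;> rw [h]
  exact hφ.even x

theorem IsOrliczNFunction.nonneg {φ : ℝ → ℝ} (hφ : IsOrliczNFunction φ) (x : ℝ) : 0 ≤ φ x := by
  rw [← hφ.map_abs, ← hφ.map_zero]
  exact hφ.monotoneOn (Set.mem_Ici.2 le_rfl) (abs_nonneg x) (abs_nonneg x)

theorem IsOrliczNFunction.exists_eq {φ : ℝ → ℝ} (hφ : IsOrliczNFunction φ) {y : ℝ}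
    (hy : 0 ≤ y) : ∃ x ∈ Set.Ici (0 : ℝ), φ x = y := by
  obtain ⟨b, hb1, hb2⟩ := ((hφ.tendsto_atTop.eventually_ge_atTop 1).and
    (eventually_ge_atTop (max y 1))).exists
  have hb0 : 0 < b := lt_of_lt_of_le one_pos ((le_max_right _ _).trans hb2)
  rw [le_div_iff₀ hb0, one_mul] at hb1
  obtain ⟨x, hx, hxy⟩ := intermediate_value_Icc hb0.le hφ.continuous.continuousOn
    (show y ∈ Set.Icc (φ 0) (φ b) from
      ⟨by rwa [hφ.map_zero], ((le_max_left _ _).trans hb2).trans hb1⟩)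
  exact ⟨x, hx.1, hxy⟩

theorem IsOrliczNFunction.le_map_of_orliczInv_le {φ : ℝ → ℝ} (hφ : IsOrliczNFunction φ) {x y : ℝ}
    (hy : 0 ≤ y) (h : orliczInv φ y ≤ x) : y ≤ φ x := by
  have hex := hφ.exists_eq hy
  have h0 : orliczInv φ y ∈ Set.Ici (0 : ℝ) := Function.invFunOn_mem hex
  have h1 : φ (orliczInv φ y) = y := Function.invFunOn_eq hex
  have := hφ.monotoneOn h0 (Set.mem_Ici.2 (le_trans h0 h)) h
  rwa [h1] at this

theorem IsDensity.nonneg {φ f : ℝ → ℝ} (hf : IsDensity φ f) {x : ℝ} (hx : 0 ≤ x) : 0 ≤ f x := by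
  have := hf.monotoneOn (Set.mem_Ici.2 le_rfl) hx hx
  rwa [hf.map_zero] at this

theorem IsDensity.sub_le {φ f : ℝ → ℝ} (hf : IsDensity φ f) {x y : ℝ} (hx : 0 ≤ x) (hxy : x ≤ y) :
    φ y - φ x ≤ f y * (y - x) := by
  have hii : ∀ a b : ℝ, 0 ≤ a → 0 ≤ b → IntervalIntegrable f volume a b := fun a b ha hb =>
    (hf.monotoneOn.mono fun v hv => (le_min ha hb).trans hv.1).intervalIntegrable
  have hy := hx.trans hxy
  rw [hf.integral_eq x, hf.integral_eq y, abs_of_nonneg hx, abs_of_nonneg hy,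
    intervalIntegral.integral_interval_sub_left (hii _ _ le_rfl hy) (hii _ _ le_rfl hx)]
  have h := intervalIntegral.integral_mono_on hxy (hii x y hx hy)
    (intervalIntegrable_const (c := f y)) fun v hv =>
      hf.monotoneOn (hx.trans hv.1) hy hv.2
  rw [intervalIntegral.integral_const, smul_eq_mul] at h
  linarith

/-- Below a point at which the density is smaller than `u`, the function `y ↦ u y - φ y` does not
exceed its value at that point. -/
theorem IsDensity.mul_sub_le {φ f : ℝ → ℝ} (hφ : IsOrliczNFunction φ) (hf : IsDensity φ f)
    {u x y : ℝ} (hu : 0 ≤ u) (hx : 0 ≤ x) (hfx : f x ≤ u) (hyx : y ≤ x) :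
    u * y - φ y ≤ u * x - φ x := by
  have key : ∀ v, 0 ≤ v → v ≤ x → u * v - φ v ≤ u * x - φ x := by
    intro v hv hvx
    have h1 := hf.sub_le hv hvx
    have h2 := mul_le_mul_of_nonneg_right hfx (sub_nonneg.2 hvx)
    linarith
  rcases le_total 0 y with h | h
  · exact key y h hyx
  · have h1 := key 0 le_rfl hx
    rw [hφ.map_zero] at h1
    have := hφ.nonneg y
    have := mul_nonpos_of_nonneg_of_nonpos hu h
    linarith

section

variable {Ω : Type*} [MeasurableSpace Ω] {P : Measure Ω}

theorem integral_exp_le_of_tau_le [IsProbabilityMeasure P] {φ : ℝ → ℝ}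
    (hφ : IsOrliczNFunction φ) {ξ : Ω → ℝ} (hξ : Integrable ξ P) (hmean : ∫ w, ξ w ∂P = 0)
    (hexp : ∀ l : ℝ, Integrable (fun w => Real.exp (l * ξ w)) P) {a : ℝ} (ha : 0 ≤ a)
    (hτ : tau φ P ξ ≤ ENNReal.ofReal a) (l : ℝ) :
    ∫ w, Real.exp (l * ξ w) ∂P ≤ Real.exp (φ (a * l)) := by
  rcases eq_or_ne l 0 with rfl | hl
  · simp [hφ.map_zero]
  -- Mean zero makes the logarithm nonnegative, which places it in the range where `orliczInv` is a
  -- genuine inverse.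
  have h1 : 1 ≤ ∫ w, Real.exp (l * ξ w) ∂P := by
    have h := integral_mono ((hξ.const_mul l).add (integrable_const 1)) (hexp l)
      fun w => Real.add_one_le_exp (l * ξ w)
    simp only [Pi.add_apply] at h
    rw [integral_add (hξ.const_mul l) (integrable_const 1), integral_const_mul, hmean] at h
    simpa using h
  have h2 : orliczInv φ (Real.log (∫ w, Real.exp (l * ξ w) ∂P)) / |l| ≤ a := by
    rw [← ENNReal.ofReal_le_ofReal_iff ha]
    exact (le_iSup₂ (f := fun (l : ℝ) (_ : l ≠ 0) => ENNReal.ofReal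
      (orliczInv φ (Real.log (∫ w, Real.exp (l * ξ w) ∂P)) / |l|)) l hl).trans hτ
  rw [div_le_iff₀ (abs_pos.2 hl)] at h2
  have h3 := hφ.le_map_of_orliczInv_le (Real.log_nonneg h1) h2
  rw [Real.log_le_iff_le_exp (by linarith)] at h3
  rwa [← hφ.map_abs, abs_mul, abs_of_nonneg ha]

theorem integrable_exp_sum [IsFiniteMeasure P] {ι : Type*} (s : Finset ι) {ξ : ι → Ω → ℝ}
    (hm : ∀ i, Measurable (ξ i))
    (h : ∀ i, ∀ l : ℝ, Integrable (fun w => Real.exp (l * ξ i w)) P) (l : ℝ) :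
    Integrable (fun w => Real.exp (l * ∑ i ∈ s, ξ i w)) P := by
  classical
  induction s using Finset.induction_on generalizing l with
  | empty => simp
  | insert i s hi ih =>
    have hms : Measurable fun w => ∑ i ∈ s, ξ i w := Finset.measurable_sum _ fun i _ => hm i
    refine ((h i (2 * l)).add (ih (2 * l))).mono' ?_ (Eventually.of_forall fun w => ?_)
    · simp_rw [Finset.sum_insert hi]
      exact (((hm i).add hms).const_mul l).exp.aestronglyMeasurable
    · rw [Finset.sum_insert hi, Real.norm_eq_abs, abs_of_pos (Real.exp_pos _), mul_add,
        Real.exp_add, Pi.add_apply]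
      have e1 : Real.exp (2 * l * ξ i w) = Real.exp (l * ξ i w) ^ 2 := by
        rw [← Real.exp_nat_mul]; ring_nf
      have e2 : Real.exp (2 * l * ∑ i ∈ s, ξ i w) = Real.exp (l * ∑ i ∈ s, ξ i w) ^ 2 := by
        rw [← Real.exp_nat_mul]; ring_nf
      rw [e1, e2]
      nlinarith [sq_nonneg (Real.exp (l * ξ i w) - Real.exp (l * ∑ i ∈ s, ξ i w)),
        sq_nonneg (Real.exp (l * ξ i w)), sq_nonneg (Real.exp (l * ∑ i ∈ s, ξ i w))]

/-- The function `x^s exp(-x)` is largest at `x = s`; equivalently, `1 + y ≤ exp y` at `y = x/s -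
1`, raised to the power `s`. -/
theorem rpow_le_mul_exp {x s : ℝ} (hx : 0 ≤ x) (hs : 0 < s) :
    x ^ s ≤ (s / Real.exp 1) ^ s * Real.exp x := by
  have h1 : x ≤ s / Real.exp 1 * Real.exp (x / s) := by
    have h := Real.add_one_le_exp (x / s - 1)
    rw [sub_add_cancel, Real.exp_sub, div_le_iff₀ hs] at h
    refine h.trans (le_of_eq ?_)
    ring
  calc x ^ s ≤ (s / Real.exp 1 * Real.exp (x / s)) ^ s := Real.rpow_le_rpow hx h1 hs.le
    _ = (s / Real.exp 1) ^ s * Real.exp x := by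
        rw [Real.mul_rpow (by positivity) (Real.exp_pos _).le, ← Real.exp_mul,
          div_mul_cancel₀ _ hs.ne']

/-- Moment bound for a random variable whose moment generating function is at most
`exp (φ (a l))`. -/
theorem lintegral_abs_div_rpow_le {φ : ℝ → ℝ} (hφ : IsOrliczNFunction φ) {ξ : Ω → ℝ}
    (hexp : ∀ l : ℝ, Integrable (fun w => Real.exp (l * ξ w)) P) {a : ℝ} (ha : 0 < a)
    (hmgf : ∀ l : ℝ, ∫ w, Real.exp (l * ξ w) ∂P ≤ Real.exp (φ (a * l))) {s l : ℝ} (hs : 0 < s)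
    (hl : 0 < l) :
    ∫⁻ w, ENNReal.ofReal ((|ξ w| / a) ^ s) ∂P ≤
      ENNReal.ofReal ((s / (Real.exp 1 * l)) ^ s * (2 * Real.exp (φ l))) := by
  set K : ℝ := (s / (Real.exp 1 * l)) ^ s with hK
  have hK0 : 0 ≤ K := by positivity
  have hpt : ∀ w, (|ξ w| / a) ^ s ≤
      K * (Real.exp (l / a * ξ w) + Real.exp (-(l / a) * ξ w)) := by
    intro w
    have h1 := rpow_le_mul_exp (x := l * (|ξ w| / a)) (by positivity) hs
    rw [Real.mul_rpow hl.le (by positivity)] at h1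
    have h2 : Real.exp (l * (|ξ w| / a)) ≤
        Real.exp (l / a * ξ w) + Real.exp (-(l / a) * ξ w) := by
      rcases abs_choice (ξ w) with h | h <;> rw [h]
      · have e : l * (ξ w / a) = l / a * ξ w := by ring
        rw [e]
        linarith [Real.exp_pos (-(l / a) * ξ w)]
      · have e : l * (-ξ w / a) = -(l / a) * ξ w := by ring
        rw [e]
        linarith [Real.exp_pos (l / a * ξ w)]
    have e : (s / Real.exp 1) ^ s = l ^ s * K := by
      rw [hK, ← Real.mul_rpow hl.le (by positivity)]
      congr 1
      field_simp
    rw [e, mul_assoc] at h1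
    exact (le_of_mul_le_mul_left h1 (Real.rpow_pos_of_pos hl s)).trans
      (mul_le_mul_of_nonneg_left h2 hK0)
  refine (lintegral_mono fun w => ENNReal.ofReal_le_ofReal (hpt w)).trans ?_
  have hi := ((hexp (l / a)).add (hexp (-(l / a)))).const_mul K
  simp only [Pi.add_apply] at hi
  rw [← ofReal_integral_eq_lintegral_ofReal hi (Eventually.of_forall fun w => by positivity)]
  refine ENNReal.ofReal_le_ofReal ?_
  rw [integral_const_mul, integral_add (hexp _) (hexp _)]
  refine mul_le_mul_of_nonneg_left ?_ hK0
  have h1 := hmgf (l / a)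
  have h2 := hmgf (-(l / a))
  rw [mul_neg, hφ.even] at h2
  rw [mul_div_cancel₀ _ ha.ne'] at h1 h2
  linarith

end

/-! ### Tail bound for the `L_p` norm of a process -/

theorem lintegral_rpow_le_measure_univ_mul {α : Type*} [MeasurableSpace α] {μ : Measure α}
    {g : α → ENNReal} (hg : Measurable g) {r : ℝ} (hr : 1 ≤ r) :
    (∫⁻ t, g t ∂μ) ^ r ≤ μ Set.univ ^ (r - 1) * ∫⁻ t, g t ^ r ∂μ := by
  have hr0 : 0 < r := by linarith
  have h := eLpNorm'_le_eLpNorm'_mul_rpow_measure_univ (μ := μ) (f := g) one_pos hr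
    hg.stronglyMeasurable.aestronglyMeasurable
  simp only [eLpNorm', enorm_eq_self, ENNReal.rpow_one, div_one] at h
  refine (ENNReal.rpow_le_rpow h hr0.le).trans (le_of_eq ?_)
  rw [ENNReal.mul_rpow_of_nonneg _ _ hr0.le, ← ENNReal.rpow_mul, ← ENNReal.rpow_mul,
    one_div_mul_cancel hr0.ne', ENNReal.rpow_one, mul_comm, sub_mul, one_mul,
    one_div_mul_cancel hr0.ne']

section

variable {Ω α : Type*} [MeasurableSpace Ω] [MeasurableSpace α] {P : Measure Ω} {ν : Measure α}

/-- Normalising `Y` by `a` moves the weight `a^p` into a measure `μ` of mass `S`. Jensen for the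
exponent `s/p ≥ 1` on `μ`, followed by Tonelli, leaves only the uniform moment bound `M`. -/
theorem lintegral_rpow_lintegral_le [SFinite P] [SFinite ν] {Y : α → Ω → ℝ}
    (hY : Measurable (fun q : α × Ω => Y q.1 q.2)) {a : α → ℝ} (ha : Measurable a)
    (hpos : ∀ᵐ t ∂ν, 0 < a t) {p s : ℝ} (hp : 0 < p) (hs : p ≤ s) {M S : ENNReal}
    (hM : ∀ᵐ t ∂ν, ∫⁻ w, ENNReal.ofReal ((|Y t w| / a t) ^ s) ∂P ≤ M)
    (hS : ∫⁻ t, ENNReal.ofReal (a t ^ p) ∂ν = S) (hS0 : S ≠ 0) (hStop : S ≠ ⊤) :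
    ∫⁻ w, (∫⁻ t, ENNReal.ofReal (|Y t w| ^ p) ∂ν) ^ (s / p) ∂P ≤ S ^ (s / p) * M := by
  have hs0 : 0 < s := hp.trans_le hs
  have hd : Measurable fun t => ENNReal.ofReal (a t ^ p) := (ha.pow_const p).ennreal_ofReal
  set μ : Measure α := ν.withDensity fun t => ENNReal.ofReal (a t ^ p) with hμ
  have hμu : μ Set.univ = S := by
    rw [hμ, withDensity_apply _ MeasurableSet.univ, Measure.restrict_univ, hS]
  have hpos' : ∀ᵐ t ∂μ, 0 < a t := (withDensity_absolutelyContinuous ν _).ae_le hpos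
  have hM' : ∀ᵐ t ∂μ, ∫⁻ w, ENNReal.ofReal ((|Y t w| / a t) ^ s) ∂P ≤ M :=
    (withDensity_absolutelyContinuous ν _).ae_le hM
  have hq : ∀ e : ℝ, Measurable fun q : α × Ω => ENNReal.ofReal ((|Y q.1 q.2| / a q.1) ^ e) :=
    fun e => (((continuous_abs.measurable.comp hY).div
      (ha.comp measurable_fst)).pow_const e).ennreal_ofReal
  have hqw : ∀ (e : ℝ) (w : Ω), Measurable fun t => ENNReal.ofReal ((|Y t w| / a t) ^ e) :=
    fun e w => (hq e).comp measurable_prodMk_right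
  have hpt : ∀ w, (∫⁻ t, ENNReal.ofReal (|Y t w| ^ p) ∂ν) ^ (s / p) ≤
      S ^ (s / p - 1) * ∫⁻ t, ENNReal.ofReal ((|Y t w| / a t) ^ s) ∂μ := by
    intro w
    have h1 : ∫⁻ t, ENNReal.ofReal (|Y t w| ^ p) ∂ν =
        ∫⁻ t, ENNReal.ofReal ((|Y t w| / a t) ^ p) ∂μ := by
      rw [hμ, lintegral_withDensity_eq_lintegral_mul ν hd (hqw p w)]
      refine lintegral_congr_ae ?_
      filter_upwards [hpos] with t ht
      rw [Pi.mul_apply, ← ENNReal.ofReal_mul (by positivity),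
        ← Real.mul_rpow ht.le (by positivity), mul_div_cancel₀ _ ht.ne']
    rw [h1]
    refine (lintegral_rpow_le_measure_univ_mul (hqw p w)
      ((one_le_div hp).2 hs)).trans (le_of_eq ?_)
    rw [hμu]
    congr 1
    refine lintegral_congr_ae ?_
    filter_upwards [hpos'] with t ht
    have hb : 0 ≤ |Y t w| / a t := by positivity
    rw [ENNReal.ofReal_rpow_of_nonneg (by positivity) (by positivity), ← Real.rpow_mul hb,
      mul_div_cancel₀ _ hp.ne']
  have hsig : SFinite μ := by rw [hμ]; infer_instance
  refine (lintegral_mono hpt).trans ?_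
  rw [lintegral_const_mul _ (Measurable.lintegral_prod_left' (f := fun q : α × Ω =>
    ENNReal.ofReal ((|Y q.1 q.2| / a q.1) ^ s)) (hq s))]
  rw [lintegral_lintegral_swap (f := fun (w : Ω) (t : α) => ENNReal.ofReal ((|Y t w| / a t) ^ s))
    ((hq s).comp measurable_swap).aemeasurable]
  refine (mul_le_mul_right (lintegral_mono_ae hM') _).trans (le_of_eq ?_)
  rw [lintegral_const, hμu, mul_comm M, ← mul_assoc]
  congr 1
  conv_lhs => rw [← ENNReal.rpow_one S, ← ENNReal.rpow_mul, one_mul]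
  rw [← ENNReal.rpow_add _ _ hS0 hStop, sub_add_cancel]

/-- Tail bound for the `L_p` norm of a process whose values have moment generating functions
bounded by `exp (φ (a t * l))`, at a fixed parameter `l`. -/
theorem measure_ge_le_two_mul_exp [SFinite P] [SFinite ν] {φ : ℝ → ℝ} (hφ : IsOrliczNFunction φ)
    {Y : α → Ω → ℝ} (hY : Measurable (fun q : α × Ω => Y q.1 q.2)) {a : α → ℝ} (ha : Measurable a)
    (hpos : ∀ᵐ t ∂ν, 0 < a t)
    (hexp : ∀ t, ∀ l : ℝ, Integrable (fun w => Real.exp (l * Y t w)) P)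
    (hmgf : ∀ᵐ t ∂ν, ∀ l : ℝ, ∫ w, Real.exp (l * Y t w) ∂P ≤ Real.exp (φ (a t * l)))
    {p S ε l : ℝ} (hp : 0 < p) (hS0 : 0 < S) (hε : 0 < ε)
    (hS : ∫⁻ t, ENNReal.ofReal (a t ^ p) ∂ν = ENNReal.ofReal S)
    (hl : p / (ε / S) ^ (1 / p) ≤ l) :
    P {w | ENNReal.ofReal ε ≤ ∫⁻ t, ENNReal.ofReal (|Y t w| ^ p) ∂ν} ≤
      ENNReal.ofReal (2 * Real.exp (-((ε / S) ^ (1 / p) * l - φ l))) := by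
  set u : ℝ := (ε / S) ^ (1 / p) with hu
  have hu0 : 0 < u := Real.rpow_pos_of_pos (by positivity) _
  have hl0 : 0 < l := lt_of_lt_of_le (by positivity) hl
  -- This order of moment makes `s/(e l) = u/e`, so the powers of `ε` and `S` cancel and the
  -- prefactor is exactly `exp(-s)`.
  set s : ℝ := u * l with hs
  have hps : p ≤ s := by rwa [div_le_iff₀ hu0, mul_comm] at hl
  have hs0 : 0 < s := hp.trans_le hps
  have hr0 : 0 < s / p := by positivity
  set J : Ω → ENNReal := fun w => ∫⁻ t, ENNReal.ofReal (|Y t w| ^ p) ∂ν with hJ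
  have hJm : Measurable J :=
    Measurable.lintegral_prod_left' (f := fun q : α × Ω => ENNReal.ofReal (|Y q.1 q.2| ^ p))
      (((continuous_abs.measurable.comp hY).pow_const p).ennreal_ofReal)
  have hmom := lintegral_rpow_lintegral_le hY ha hpos hp hps
    (M := ENNReal.ofReal ((s / (Real.exp 1 * l)) ^ s * (2 * Real.exp (φ l))))
    (by
      filter_upwards [hpos, hmgf] with t ht htm
      exact lintegral_abs_div_rpow_le hφ (hexp t) ht htm hs0 hl0)
    hS (by simpa using hS0) ENNReal.ofReal_ne_top
  have hsub : {w | ENNReal.ofReal ε ≤ J w} ⊆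
      {w | ENNReal.ofReal ε ^ (s / p) ≤ J w ^ (s / p)} := fun w hw =>
    ENNReal.rpow_le_rpow hw hr0.le
  have hεr : ENNReal.ofReal ε ^ (s / p) = ENNReal.ofReal (ε ^ (s / p)) :=
    ENNReal.ofReal_rpow_of_pos hε
  have hεr0 : 0 < ε ^ (s / p) := Real.rpow_pos_of_pos hε _
  refine (measure_mono hsub).trans ((meas_ge_le_lintegral_div
    (hJm.pow_const (s / p)).aemeasurable (by rw [hεr]; simpa using hεr0)
    (by rw [hεr]; exact ENNReal.ofReal_ne_top)).trans ?_)
  refine (ENNReal.div_le_div_right hmom _).trans (le_of_eq ?_)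
  rw [hεr, ENNReal.ofReal_rpow_of_pos hS0, ← ENNReal.ofReal_mul (by positivity),
    ← ENNReal.ofReal_div_of_pos hεr0]
  congr 1
  have h1 : s / (Real.exp 1 * l) = u / Real.exp 1 := by
    rw [hs]
    field_simp
  have h2 : u ^ s = ε ^ (s / p) / S ^ (s / p) := by
    rw [hu, ← Real.rpow_mul (by positivity), ← Real.div_rpow hε.le hS0.le]
    congr 1
    ring
  have h3 : Real.exp 1 ^ s = Real.exp s := Real.exp_one_rpow s
  have hSr : 0 < S ^ (s / p) := Real.rpow_pos_of_pos hS0 _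
  rw [h1, Real.div_rpow hu0.le (Real.exp_pos 1).le, h2, h3, neg_sub, Real.exp_sub]
  field_simp

/-- Tail bound for the `L_p` norm of a process whose values have moment generating functions
bounded by `exp (φ (a t * l))`. -/
theorem measure_ge_le_of_youngFenchel [IsFiniteMeasure P] [SFinite ν] {φ f : ℝ → ℝ}
    (hφ : IsOrliczNFunction φ) (hf : IsDensity φ f)
    {Y : α → Ω → ℝ} (hY : Measurable (fun q : α × Ω => Y q.1 q.2)) {a : α → ℝ} (ha : Measurable a)
    (hpos : ∀ᵐ t ∂ν, 0 < a t)
    (hexp : ∀ t, ∀ l : ℝ, Integrable (fun w => Real.exp (l * Y t w)) P)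
    (hmgf : ∀ᵐ t ∂ν, ∀ l : ℝ, ∫ w, Real.exp (l * Y t w) ∂P ≤ Real.exp (φ (a t * l)))
    {p S ε : ℝ} (hp : 0 < p) (hS0 : 0 < S) (hε : 0 < ε)
    (hS : ∫⁻ t, ENNReal.ofReal (a t ^ p) ∂ν = ENNReal.ofReal S)
    (hfS : S * f (p * (S / ε) ^ (1 / p)) ^ p < ε) :
    P.real {w | ENNReal.ofReal ε ≤ ∫⁻ t, ENNReal.ofReal (|Y t w| ^ p) ∂ν} ≤
      2 * Real.exp (-youngFenchel φ ((ε / S) ^ (1 / p))) := by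
  set u : ℝ := (ε / S) ^ (1 / p) with hu
  have hu0 : 0 < u := Real.rpow_pos_of_pos (by positivity) _
  have hinv : p * (S / ε) ^ (1 / p) = p / u := by
    rw [hu, ← inv_div ε S, Real.inv_rpow (by positivity), ← div_eq_mul_inv]
  rw [hinv] at hfS
  have hpu : 0 ≤ p / u := by positivity
  have hfu : f (p / u) ≤ u := by
    have h1 : f (p / u) ^ p < u ^ p := by
      rw [hu, ← Real.rpow_mul (by positivity), one_div_mul_cancel hp.ne', Real.rpow_one,
        lt_div_iff₀ hS0, mul_comm]
      exact hfS
    exact ((Real.rpow_lt_rpow_iff (hf.nonneg hpu) hu0.le hp).1 h1).le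
  set Q : ℝ := P.real {w | ENNReal.ofReal ε ≤ ∫⁻ t, ENNReal.ofReal (|Y t w| ^ p) ∂ν} with hQ
  have hbig : ∀ l, p / u ≤ l → Q ≤ 2 * Real.exp (-(u * l - φ l)) := fun l hl =>
    ENNReal.toReal_le_of_le_ofReal (by positivity)
      (measure_ge_le_two_mul_exp hφ hY ha hpos hexp hmgf hp hS0 hε hS hl)
  -- For `l < p/u` the moment argument is unavailable, but `f (p/u) ≤ u` makes the bound at `p/u` at
  -- least as strong as the one claimed at `l`.
  have hall : ∀ l, Q ≤ 2 * Real.exp (-(u * l - φ l)) := by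
    intro l
    rcases le_total (p / u) l with hl | hl
    · exact hbig l hl
    · refine (hbig _ le_rfl).trans ?_
      have := hf.mul_sub_le hφ hu0.le hpu hfu hl
      gcongr
  have hQ0 : 0 ≤ Q := measureReal_nonneg
  rcases hQ0.eq_or_lt with h | h
  · rw [← h]
    positivity
  -- When `Q > 0`, the tail bounds themselves bound the set under the supremum.
  · have hsup : youngFenchel φ u ≤ -Real.log (Q / 2) := by
      refine ciSup_le fun l => ?_
      have h1 : Q / 2 ≤ Real.exp (-(u * l - φ l)) := by linarith [hall l]
      have h2 := (Real.log_le_iff_le_exp (by positivity)).2 h1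
      linarith
    have h3 : Q / 2 ≤ Real.exp (-youngFenchel φ u) :=
      (Real.log_le_iff_le_exp (by positivity)).1 (by linarith)
    linarith

end

/-! ### The truncation error as a process -/

theorem measurable_boundA (B0 : ℝ) (F : Measure ℝ) (ω z : ℝ) (n : ℕ) (Λ : ℝ) :
    Measurable fun t => boundA B0 F ω z n t Λ := by
  have hC : Continuous fun t => coefC B0 ω z n t Λ := by
    unfold coefC
    fun_prop
  have hD : Measurable fun t => coefD ω n t := by
    have hs : Measurable fun t => |Real.sin (ω * t)| := by fun_prop
    unfold coefD
    fun_prop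
  exact (hC.measurable.sqrt.div_const _).add (hD.mul_const _)

theorem continuousOn_boundA (B0 : ℝ) (F : Measure ℝ) {ω : ℝ} (z : ℝ) {n : ℕ} (Λ : ℝ) {s : Set ℝ}
    (hs : ∀ t ∈ s, ω * t / Real.pi < n) :
    ContinuousOn (fun t => boundA B0 F ω z n t Λ) s := by
  have hC : Continuous fun t => coefC B0 ω z n t Λ := by
    unfold coefC
    fun_prop
  have hD : ContinuousOn (fun t => coefD ω n t) s := by
    have h1 : Continuous fun t => 2 * |Real.sin (ω * t)| / Real.pi := by fun_prop
    have h2 : ContinuousOn (fun t => (ω * t / Real.pi + 0.5) / ((n : ℝ) - ω * t / Real.pi)) s :=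
      ContinuousOn.div (by fun_prop) (by fun_prop) fun t ht => (sub_pos.2 (hs t ht)).ne'
    exact continuousOn_const.add (h1.continuousOn.mul (continuousOn_const.add h2))
  exact (hC.sqrt.div_const _).continuousOn.add (hD.mul continuousOn_const)

theorem boundA_pos {B0 : ℝ} (hB0 : 0 < B0) (F : Measure ℝ) {ω z Λ : ℝ} {n : ℕ} {t : ℝ}
    (hn0 : 0 < n) (hz0 : 0 < z) (hz1 : z < 1) (hΛ : 0 < Λ) (hΛω : Λ < ω)
    (h0 : 0 ≤ ω * t / Real.pi) (hlt : ω * t / Real.pi < n) : 0 < boundA B0 F ω z n t Λ := by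
  have hpi := Real.pi_pos
  have hω := hΛ.trans hΛω
  have hn0' : (0 : ℝ) < n := by exact_mod_cast hn0
  have hz : 0 < 1 - z := by linarith
  have hΛ1 : 0 < 1 - Λ / ω := by rw [sub_pos, div_lt_one hω]; exact hΛω
  have h1 : 0 ≤ 4 * ω * t / (Real.pi ^ 2 * (1 - z)) := by
    have e : 4 * ω * t / (Real.pi ^ 2 * (1 - z)) =
        ω * t / Real.pi * (4 / (Real.pi * (1 - z))) := by
      field_simp
    rw [e]
    positivity
  have hC : 0 < coefC B0 ω z n t Λ := by
    unfold coefC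
    positivity
  exact add_pos_of_pos_of_nonneg (div_pos (Real.sqrt_pos.2 hC) hn0')
    (mul_nonneg (coefD_nonneg h0 hlt) (Real.sqrt_nonneg _))

theorem measurable_sub_truncated {Ω : Type*} [MeasurableSpace Ω] {X : ℝ → Ω → ℝ}
    (hX : Measurable fun q : ℝ × Ω => X q.1 q.2) (ω : ℝ) (n : ℕ) :
    Measurable fun q : ℝ × Ω => X q.1 q.2 - truncated ω n X q.1 q.2 := by
  refine hX.sub (Finset.measurable_sum _ fun k _ => ?_)
  have h1 : Measurable fun q : ℝ × Ω =>
      Real.sinc (ω * (q.1 - (k : ℝ) * Real.pi / ω)) :=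
    Real.measurable_sinc.comp (by fun_prop)
  have h2 : Measurable (X ((k : ℝ) * Real.pi / ω)) := hX.comp measurable_prodMk_left
  exact h1.mul (h2.comp measurable_snd)

section

variable {Ω : Type*} [MeasurableSpace Ω] {P : Measure Ω} {X : ℝ → Ω → ℝ}

theorem memLp_sub_truncated (hstat : IsStationary P X) (ω : ℝ) (n : ℕ) (t : ℝ) :
    MemLp (fun w => X t w - truncated ω n X t w) 2 P := by
  simp_rw [sub_truncated_eq_sum]
  exact memLp_finsetSum _ fun i _ => (hstat.memLp _).const_mul _

theorem integral_sub_truncated [IsProbabilityMeasure P] (hstat : IsStationary P X) (ω : ℝ) (n : ℕ)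
    (t : ℝ) : ∫ w, X t w - truncated ω n X t w ∂P = 0 := by
  simp_rw [sub_truncated_eq_sum]
  rw [integral_finsetSum _ fun i _ =>
    ((hstat.memLp (errorTime ω t i)).integrable one_le_two).const_mul _]
  refine Finset.sum_eq_zero fun i _ => ?_
  rw [integral_const_mul, hstat.mean_zero, mul_zero]

theorem integrable_exp_sub_truncated [IsProbabilityMeasure P] {φ : ℝ → ℝ}
    (hX : Measurable fun q : ℝ × Ω => X q.1 q.2) (hsub : ∀ t, IsSub φ P (X t)) (ω : ℝ) (n : ℕ)
    (t l : ℝ) : Integrable (fun w => Real.exp (l * (X t w - truncated ω n X t w))) P := by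
  simp_rw [sub_truncated_eq_sum]
  refine integrable_exp_sum _ (ξ := fun i w => errorCoef ω t i * X (errorTime ω t i) w)
    (fun i => (hX.comp measurable_prodMk_left).const_mul _) (fun i l => ?_) l
  obtain ⟨-, -, a, -, h⟩ := hsub (errorTime ω t i)
  simpa only [mul_assoc] using (h (l * errorCoef ω t i)).1

end

/-- If the `L_p` distance is finite on average, then `L_p`-approximation follows from a tail bound
for its `[0, ∞]`-valued version. -/
theorem approximatesInLp_of_measure_ge_le {Ω : Type*} [MeasurableSpace Ω] {P : Measure Ω}
    [SFinite P] {X Y : ℝ → Ω → ℝ} (hXY : Measurable fun q : ℝ × Ω => X q.1 q.2 - Y q.1 q.2)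
    {p T ε δ : ℝ} (hε : 0 < ε)
    (hfin : ∫⁻ w, (∫⁻ t in Set.Icc 0 T, ENNReal.ofReal (|X t w - Y t w| ^ p)) ∂P ≠ ⊤)
    (htail : P {w | ENNReal.ofReal ε ≤ ∫⁻ t in Set.Icc 0 T,
      ENNReal.ofReal (|X t w - Y t w| ^ p)} ≤ ENNReal.ofReal δ) :
    ApproximatesInLp P X Y p T ε δ := by
  have hg : Measurable fun q : ℝ × Ω => |X q.1 q.2 - Y q.1 q.2| ^ p :=
    (continuous_abs.measurable.comp hXY).pow_const p
  have hgw : ∀ w, Measurable fun t => |X t w - Y t w| ^ p := fun w =>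
    hg.comp measurable_prodMk_right
  have hJm : Measurable fun w => ∫⁻ t in Set.Icc 0 T, ENNReal.ofReal (|X t w - Y t w| ^ p) :=
    Measurable.lintegral_prod_left'
      (f := fun q : ℝ × Ω => ENNReal.ofReal (|X q.1 q.2 - Y q.1 q.2| ^ p)) hg.ennreal_ofReal
  constructor
  · filter_upwards [ae_lt_top hJm hfin] with w hw
    refine ⟨(hgw w).aestronglyMeasurable, ?_⟩
    rw [hasFiniteIntegral_iff_ofReal (Eventually.of_forall fun t => by positivity)]
    exact hw
  · refine (measure_mono fun w hw => ?_).trans htail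
    have hw' : ε < ∫ t in Set.Icc 0 T, |X t w - Y t w| ^ p := hw
    have hi : Integrable (fun t => |X t w - Y t w| ^ p) (volume.restrict (Set.Icc 0 T)) := by
      -- A non-integrable function has Bochner integral `0`, which cannot exceed `ε > 0`.
      by_contra h
      rw [integral_undef h] at hw'
      linarith
    change ENNReal.ofReal ε ≤ _
    rw [← ofReal_integral_eq_lintegral_ofReal hi (Eventually.of_forall fun t => by positivity)]
    exact ENNReal.ofReal_le_ofReal hw'.le

end WKS

/-- The truncated sampling sum `X_n` approximates the stationary strictly `φ`-sub-Gaussian process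
`X` in `L_p([0,T])` with accuracy `ε` and reliability `1 - δ`. If `S_{n,p} = 0`, then
`ε / S_{n,p} = +∞`, and the second inequality reads `0 ≤ δ / 2`. -/
theorem mainTheorem4 {Ω : Type*} [MeasurableSpace Ω] (P : MeasureTheory.Measure Ω)
    [MeasureTheory.IsProbabilityMeasure P]
    (φ f : ℝ → ℝ) (hφ : WKS.IsOrliczNFunction φ) (hQ : WKS.ConditionQ φ)
    (hf : WKS.IsDensity φ f)
    (X : ℝ → Ω → ℝ) (hmeas : Measurable (fun q : ℝ × Ω => X q.1 q.2))
    (hstat : WKS.IsStationary P X) (hsub : WKS.IsSSub φ P X)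
    (CX : ℝ) (hCX : WKS.IsDeterminativeConstant φ P X CX)
    (F : MeasureTheory.Measure ℝ) (hF : WKS.IsSpectralMeasure P X F)
    (p T ω Λ z : ℝ) (n : ℕ) (hp : 1 ≤ p) (hT : 0 < T) (hΛ : 0 < Λ) (hΛω : Λ < ω)
    (hz0 : 0 < z) (hz1 : z < 1) (hn : ω * T / (Real.pi * Real.sqrt z) ≤ (n : ℝ))
    (ε δ : ℝ) (hε : 0 < ε) (hδ0 : 0 < δ) (hδ1 : δ < 1)
    (S : ℝ) (hS : S = WKS.boundS CX (WKS.covFun P X 0) F ω z n Λ p T)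
    (h₁ : S * f (p * (S / ε) ^ (1 / p)) ^ p < ε)
    (h₂ : S = 0 ∨ Real.exp (-WKS.youngFenchel φ ((ε / S) ^ (1 / p))) ≤ δ / 2) :
    WKS.ApproximatesInLp P X (WKS.truncated ω n X) p T ε δ := by
  have hω : 0 < ω := hΛ.trans hΛω
  have hp0 : 0 < p := by linarith
  have hFfin := hF.1
  have hpos := fun t (ht : t ∈ Set.Icc 0 T) => WKS.sampling_position_lt hω hT hz0 hz1 hn ht
  set A : ℝ → ℝ := fun t => WKS.boundA (WKS.covFun P X 0) F ω z n t Λ with hA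
  have hAm : Measurable A := WKS.measurable_boundA _ F ω z n Λ
  have hA0 : ∀ t ∈ Set.Icc 0 T, 0 ≤ A t := fun t ht =>
    WKS.boundA_nonneg F z Λ (hpos t ht).2.1 (hpos t ht).2.2.1
  have hAc : ContinuousOn A (Set.Icc 0 T) :=
    WKS.continuousOn_boundA _ F z Λ fun t ht => (hpos t ht).2.2.1
  have hAi : IntegrableOn (fun t => A t ^ p) (Set.Icc 0 T) :=
    (hAc.rpow_const fun t _ => Or.inr hp0.le).integrableOn_Icc
  have hAp0 : ∀ᵐ t ∂(volume.restrict (Set.Icc 0 T)), 0 ≤ A t ^ p := by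
    filter_upwards [ae_restrict_mem measurableSet_Icc] with t ht
    exact Real.rpow_nonneg (hA0 t ht) p
  have hSeq : S = CX ^ p * ∫ t in Set.Icc 0 T, A t ^ p := hS
  have hCXp : 0 < CX ^ p := Real.rpow_pos_of_pos hCX.1 p
  have hYm := WKS.measurable_sub_truncated hmeas ω n
  have hexp := WKS.integrable_exp_sub_truncated hmeas hsub.1 ω n
  set Y : ℝ → Ω → ℝ := fun t w => X t w - WKS.truncated ω n X t w with hY
  have hYm' : Measurable fun q : ℝ × Ω => Y q.1 q.2 := hYm
  have hswap : ∫⁻ w, (∫⁻ t in Set.Icc 0 T, ENNReal.ofReal (|Y t w| ^ p)) ∂P =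
      ∫⁻ t in Set.Icc 0 T, (∫⁻ w, ENNReal.ofReal (|Y t w| ^ p) ∂P) :=
    (lintegral_lintegral_swap (f := fun (t : ℝ) (w : Ω) => ENNReal.ofReal (|Y t w| ^ p))
      ((continuous_abs.measurable.comp hYm').pow_const p).ennreal_ofReal.aemeasurable).symm
  -- If `S = 0`, then `A_n` vanishes for almost every `t`, and the mean square bound makes the error
  -- vanish almost surely at each of those times.
  rcases eq_or_ne S 0 with hS0 | hS0
  · have hAz : ∀ᵐ t ∂(volume.restrict (Set.Icc 0 T)), A t ^ p = 0 := by
      rw [hS0, eq_comm, mul_eq_zero, or_iff_right hCXp.ne'] at hSeq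
      exact (integral_eq_zero_iff_of_nonneg_ae hAp0 hAi).1 hSeq
    have hzero : ∫⁻ w, (∫⁻ t in Set.Icc 0 T, ENNReal.ofReal (|Y t w| ^ p)) ∂P = 0 := by
      rw [hswap]
      refine (lintegral_congr_ae ?_).trans lintegral_zero
      filter_upwards [hAz, ae_restrict_mem measurableSet_Icc] with t htz ht
      have hAt : A t = 0 := ((Real.rpow_eq_zero_iff_of_nonneg (hA0 t ht)).1 htz).1
      have hsq := WKS.integral_sub_truncated_sq_le hF hstat hT hΛ hΛω hz0 hz1 hn ht
      have hsq' : ∫ w, Y t w ^ 2 ∂P ≤ A t ^ 2 := hsq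
      rw [hAt, zero_pow two_ne_zero] at hsq'
      have hY0 := (integral_eq_zero_iff_of_nonneg (fun w => sq_nonneg (Y t w))
        (WKS.memLp_sub_truncated hstat ω n t).integrable_sq).1
        (le_antisymm hsq' (integral_nonneg fun w => sq_nonneg _))
      refine (lintegral_congr_ae ?_).trans lintegral_zero
      filter_upwards [hY0] with w hw
      have hw0 : Y t w = 0 := pow_eq_zero_iff two_ne_zero |>.1 hw
      rw [hw0, abs_zero, Real.zero_rpow hp0.ne', ENNReal.ofReal_zero]
    refine WKS.approximatesInLp_of_measure_ge_le hYm hε (hzero.trans_ne ENNReal.zero_ne_top) ?_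
    have hJm : Measurable fun w => ∫⁻ t in Set.Icc 0 T, ENNReal.ofReal (|Y t w| ^ p) :=
      Measurable.lintegral_prod_left' (f := fun q : ℝ × Ω => ENNReal.ofReal (|Y q.1 q.2| ^ p))
        ((continuous_abs.measurable.comp hYm').pow_const p).ennreal_ofReal
    refine (meas_ge_le_lintegral_div hJm.aemeasurable (by simpa using hε)
      ENNReal.ofReal_ne_top).trans ?_
    rw [hzero, ENNReal.zero_div]
    exact zero_le
  have hSpos : 0 < S :=
    lt_of_le_of_ne (hSeq ▸ mul_nonneg hCXp.le (integral_nonneg_of_ae hAp0)) hS0.symm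
  -- Since `B(0) = F(ℝ)`, `B(0) = 0` would make `A_n`, and so `S`, vanish. Positivity gives `A_n >
  -- 0` on all of `[0, T]`, as needed for dividing by it.
  have hB0 : 0 < WKS.covFun P X 0 := by
    have h0 : 0 ≤ WKS.covFun P X 0 := by rw [hF.covFun_zero]; exact measureReal_nonneg
    refine lt_of_le_of_ne h0 fun h => hS0 ?_
    have hFz : F.real {x : ℝ | Λ < |x|} = 0 :=
      le_antisymm ((measureReal_mono (Set.subset_univ _)).trans
        (by rw [← hF.covFun_zero, ← h])) measureReal_nonneg
    have hAt : ∀ t, A t = 0 := by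
      intro t
      simp only [hA, WKS.boundA, WKS.coefC, ← h, hFz]
      simp
    rw [hSeq]
    simp [hAt, Real.zero_rpow hp0.ne']
  have hApos : ∀ t ∈ Set.Icc 0 T, 0 < CX * A t := fun t ht =>
    mul_pos hCX.1 (WKS.boundA_pos hB0 F (hpos t ht).1 hz0 hz1 hΛ hΛω (hpos t ht).2.1
      (hpos t ht).2.2.1)
  have hposae : ∀ᵐ t ∂(volume.restrict (Set.Icc 0 T)), 0 < CX * A t := by
    filter_upwards [ae_restrict_mem measurableSet_Icc] with t ht using hApos t ht
  have hmgf : ∀ᵐ t ∂(volume.restrict (Set.Icc 0 T)), ∀ l : ℝ,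
      ∫ w, Real.exp (l * Y t w) ∂P ≤ Real.exp (φ (CX * A t * l)) := by
    filter_upwards [ae_restrict_mem measurableSet_Icc] with t ht l
    exact WKS.integral_exp_le_of_tau_le hφ
      ((WKS.memLp_sub_truncated hstat ω n t).integrable one_le_two)
      (WKS.integral_sub_truncated hstat ω n t) (hexp t) (hApos t ht).le
      (WKS.tau_sub_truncated_le hCX hF hstat hT hΛ hΛω hz0 hz1 hn ht) l
  have hSlint : ∫⁻ t in Set.Icc 0 T, ENNReal.ofReal ((CX * A t) ^ p) = ENNReal.ofReal S := by
    rw [hSeq, ← integral_const_mul, ofReal_integral_eq_lintegral_ofReal (hAi.const_mul _)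
      (by filter_upwards [hAp0] with t ht using mul_nonneg hCXp.le ht)]
    refine setLIntegral_congr_fun measurableSet_Icc fun t ht => ?_
    rw [Real.mul_rpow hCX.1.le (hA0 t ht)]
  have ha : Measurable fun t => CX * A t := hAm.const_mul CX
  -- The moment estimate at `s = p`, with the arbitrary choice `l = 1`, supplies almost sure
  -- existence of the integral.
  have hfin : ∫⁻ w, (∫⁻ t in Set.Icc 0 T, ENNReal.ofReal (|Y t w| ^ p)) ∂P ≠ ⊤ := by
    have h := WKS.lintegral_rpow_lintegral_le hYm' ha hposae hp0 le_rfl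
      (M := ENNReal.ofReal ((p / (Real.exp 1 * 1)) ^ p * (2 * Real.exp (φ 1))))
      (by
        filter_upwards [hposae, hmgf] with t ht htm
        exact WKS.lintegral_abs_div_rpow_le hφ (hexp t) ht htm hp0 one_pos)
      hSlint (by simpa using hSpos) ENNReal.ofReal_ne_top
    rw [div_self hp0.ne'] at h
    simp only [ENNReal.rpow_one] at h
    exact ne_top_of_le_ne_top (ENNReal.mul_ne_top ENNReal.ofReal_ne_top ENNReal.ofReal_ne_top) h
  refine WKS.approximatesInLp_of_measure_ge_le hYm hε hfin ?_
  have htail := WKS.measure_ge_le_of_youngFenchel hφ hf hYm' ha hposae hexp hmgf hp0 hSpos hε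
    hSlint h₁
  rw [← ENNReal.ofReal_toReal (measure_ne_top P _)]
  refine ENNReal.ofReal_le_ofReal (htail.trans ?_)
  have := h₂.resolve_left hS0
  linarith
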